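/- Let $n\ge 1$ be an integer, let $q,t\in\mathbb{C}^\ast$ with $|q|<1$, and let $s=(s_1,\ldots,s_n)\in(\mathbb{C}^\ast)^n$ satisfy $s_j/s_i\notin\{q^m : m\in\mathbb{Z}\setminus\{0\}\}$ for all $1\le i<j\le n$. Let $$R=\mathbb{C}[[px_1/x_n,\,x_2/x_1,\,\ldots,\,x_n/x_{n-1}]]$$ be the ring of formal power series in the $n$ variables $z_0=px_1/x_n$, $z_k=x_{k+1}/x_k$ $(1\le k\le n-1)$; it contains $\mathbb{C}[[p]]$ through $p=z_0z_1\cdots z_{n-1}$. Put $\theta(z;p)=\prod_{k\ge0}(1-p^kz)(1-p^{k+1}/z)$, and for $I\subseteq\{1,\ldots,n\}$ let $$\mathcal{B}_I(x;p)=\prod_{\substack{1\le i<j\le n\\ i\in I,\,j\notin I}}\frac{\theta(x_j/(tx_i);p)}{\theta(x_j/x_i;p)}\prod_{\substack{1\le i<j\le n\\ i\notin I,\,j\in I}}\frac{\theta(tx_j/x_i;p)}{\theta(x_j/x_i;p)}\in R,$$ expanded as a power series in $z_0,\ldots,z_{n-1}$. Let $T_{q,x_i}$ be the $q$-shift operator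 $x_i\mapsto qx_i$ (with $p$ and the other $x_j$ fixed), acting on $R$. The modified elliptic Ruijsenaars operators are the operators $$\mathcal{E}^{(r)}_{x,s}(p)=\sum_{I\subseteq\{1,\ldots,n\},\ |I|=r}\Big(\prod_{i\in I}s_i\Big)\,\mathcal{B}_I(x;p)\prod_{i\in I}T_{q,x_i}\qquad(r=1,\ldots,n)$$ on $R$. A *formal solution* is an $f\in R$ with leading term $1$ (that is, with constant term $1$ as a power series in $z_0,\ldots,z_{n-1}$) such that $\mathcal{E}^{(r)}_{x,s}(p)f=\varepsilon^{(r)}(s;p)f$ for $r=1,\ldots,n$ with some formal eigenvalues $\varepsilon^{(r)}(s;p)\in\mathbb{C}[[p]]$. Then a formal solution $f(x;s;p)$ exists. The formal eigenvalues $\varepsilon^{(r)}(s;p)$ $(r=1,\ldots,n)$ are uniquely determined, i.e. they are the same for all formal solutions. The formal solution is unique up to multiplication by a power series in $p$ with constant term $1$: an element $g\in R$ is a formal solution if and only if $g=\gamma(s;p)\,f(x;s;p)$ for some $\gamma(s;p)\in\mathbb{C}[[p]]$ with $\gamma(s;0)=1$. -/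

import Mathlib

/-!
The ring `ℂ⟦p x₁/xₙ, x₂/x₁, …, xₙ/xₙ₋₁⟧` is `MvPowerSeries (Fin n) ℂ`.  The position variables
are indexed by `Fin n` (so `x i` is the variable usually written `x_{i+1}`), and the variable
`X k` of the ring stands for `z_k`, where `z_0 = p x_0 / x_{n-1}` and `z_k = x_k / x_{k-1}`
for `k ≠ 0`.
-/

namespace Ruijsenaars

noncomputable section

/-- The nome `p = z_0 z_1 ⋯ z_{n-1}` as an element of the ring. -/
def nome (n : ℕ) : MvPowerSeries (Fin n) ℂ :=
  ∏ k : Fin n, MvPowerSeries.X k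

/-- For `i < j`: the monomial `x_j / x_i = z_{i+1} ⋯ z_j`. -/
def ratio {n : ℕ} (i j : Fin n) : MvPowerSeries (Fin n) ℂ :=
  ∏ k ∈ Finset.Ioc i j, MvPowerSeries.X k

/-- For `i < j`: the monomial `p x_i / x_j`, the product of all `z_k` that do not occur in
`x_j / x_i`. -/
def nomeRatio {n : ℕ} (i j : Fin n) : MvPowerSeries (Fin n) ℂ :=
  ∏ k ∈ (Finset.Ioc i j)ᶜ, MvPowerSeries.X k

/-- `p = (x_j / x_i) · (p x_i / x_j)`. -/
theorem ratio_mul_nomeRatio {n : ℕ} (i j : Fin n) : ratio i j * nomeRatio i j = nome n :=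
  Finset.prod_mul_prod_compl _ _

open scoped MvPowerSeries.WithPiTopology in
/-- The infinite shifted factorial `(a; p)_∞ = ∏_{k ≥ 0} (1 - p^k a)`, an infinite product of
formal power series (coefficientwise convergence). -/
def pochhammerInf {n : ℕ} (a : MvPowerSeries (Fin n) ℂ) : MvPowerSeries (Fin n) ℂ :=
  ∏' k : ℕ, (1 - nome n ^ k * a)

open scoped MvPowerSeries.WithPiTopology in
/-- The product that defines `(a; p)_∞` converges. -/
theorem multipliable_pochhammerInf {n : ℕ} [NeZero n] (a : MvPowerSeries (Fin n) ℂ) :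
    Multipliable fun k : ℕ => (1 - nome n ^ k * a) := by
  have hp : (1 : ℕ∞) ≤ (nome n).order := by
    rw [MvPowerSeries.one_le_order_iff_constCoeff_eq_zero]
    simp [nome, map_prod, NeZero.ne n]
  have h : Filter.Tendsto (fun k : ℕ => (-(nome n ^ k * a)).order) Filter.atTop (nhds ⊤) := by
    refine tendsto_of_tendsto_of_tendsto_of_le_of_le
      (g := fun k : ℕ => (k : ℕ∞)) ENat.tendsto_natCast_nhds_top tendsto_const_nhds ?_ ?_
    · intro k
      have h1 : (k : ℕ∞) ≤ (nome n ^ k).order := by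
        refine le_trans ?_ (MvPowerSeries.le_order_pow k)
        simpa using nsmul_le_nsmul_right hp k
      change (k : ℕ∞) ≤ (-(nome n ^ k * a)).order
      rw [MvPowerSeries.order_neg]
      exact le_trans (le_trans h1 le_self_add) MvPowerSeries.le_order_mul
    · intro k
      exact le_top
  simpa [sub_eq_add_neg] using
    MvPowerSeries.WithPiTopology.multipliable_one_add_of_tendsto_order_atTop_nhds_top h

/-- For `i < j` and `c ≠ 0`: the theta function
`θ(c x_j / x_i; p) = (c x_j / x_i; p)_∞ (c⁻¹ p x_i / x_j; p)_∞`. -/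
def theta {n : ℕ} (c : ℂ) (i j : Fin n) : MvPowerSeries (Fin n) ℂ :=
  pochhammerInf (MvPowerSeries.C c * ratio i j) *
    pochhammerInf (MvPowerSeries.C c⁻¹ * nomeRatio i j)

/-- The coefficient `𝓑_I(x; p)`.  For `i < j` the series `θ(x_j / x_i; p)` has constant term `1`,
so that its inverse is a genuine inverse in the ring. -/
def coeffB {n : ℕ} (t : ℂ) (I : Finset (Fin n)) : MvPowerSeries (Fin n) ℂ :=
  (∏ ij : Fin n × Fin n with ij.1 < ij.2 ∧ ij.1 ∈ I ∧ ij.2 ∉ I,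
      theta t⁻¹ ij.1 ij.2 * (theta 1 ij.1 ij.2)⁻¹) *
    ∏ ij : Fin n × Fin n with ij.1 < ij.2 ∧ ij.1 ∉ I ∧ ij.2 ∈ I,
      theta t ij.1 ij.2 * (theta 1 ij.1 ij.2)⁻¹

/-- The exponent of `x_i` in the monomial `∏ z_k ^ d k`: the variable `x_i` occurs in `z_i` with
exponent `1` and in `z_{i+1}` with exponent `-1`, where indices are taken modulo `n`. -/
def xExponent {n : ℕ} [NeZero n] (d : Fin n →₀ ℕ) (i : Fin n) : ℤ :=
  (d i : ℤ) - (d (i + 1) : ℤ)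

/-- The `q`-shift operator `T_{q,x}^I = ∏_{i ∈ I} T_{q,x_i}`, where `T_{q,x_i}` replaces `x_i`
by `q x_i`. -/
def qShift {n : ℕ} [NeZero n] (q : ℂ) (I : Finset (Fin n)) (f : MvPowerSeries (Fin n) ℂ) :
    MvPowerSeries (Fin n) ℂ :=
  fun d => (∏ i ∈ I, q ^ xExponent d i) * MvPowerSeries.coeff d f

/-- The modified elliptic Ruijsenaars operator
`𝓔^{(r)}_{x,s}(p) = ∑_{|I| = r} s^I 𝓑_I(x; p) T_{q,x}^I`. -/
def modifiedOperator {n : ℕ} [NeZero n] (q t : ℂ) (s : Fin n → ℂ) (r : ℕ)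
    (f : MvPowerSeries (Fin n) ℂ) : MvPowerSeries (Fin n) ℂ :=
  ∑ I ∈ Finset.powersetCard r (Finset.univ : Finset (Fin n)),
    MvPowerSeries.C (∏ i ∈ I, s i) * coeffB t I * qShift q I f

/-- The embedding `ℂ⟦p⟧ → ℂ⟦p x₁/xₙ, x₂/x₁, …, xₙ/xₙ₋₁⟧`. -/
def ofNome {n : ℕ} (g : PowerSeries ℂ) : MvPowerSeries (Fin n) ℂ :=
  PowerSeries.subst (nome n) g

/-- The substitution in `ofNome` is an admissible one. -/
theorem hasSubst_nome (n : ℕ) [NeZero n] : PowerSeries.HasSubst (nome n) := by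
  apply PowerSeries.HasSubst.of_constantCoeff_zero
  simp [nome, map_prod, NeZero.ne n]

/-- `f` has leading term `1` and is a joint formal eigenfunction of the modified elliptic
Ruijsenaars operators, with formal eigenvalues `ε r ∈ ℂ⟦p⟧` for `r = 1, …, n`
(the values of `ε` at other `r` are irrelevant). -/
def IsFormalSolution {n : ℕ} [NeZero n] (q t : ℂ) (s : Fin n → ℂ)
    (f : MvPowerSeries (Fin n) ℂ) (ε : ℕ → PowerSeries ℂ) : Prop :=
  MvPowerSeries.constantCoeff f = 1 ∧
    ∀ r ∈ Finset.Icc 1 n, modifiedOperator q t s r f = ofNome (ε r) * f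

end

end Ruijsenaars

/-! Order the monomials `z ^ d` componentwise and write `μ_i = xExponent d i`. Every `𝓑_I` has
constant term `1`, so `𝓔^{(r)}` is triangular, its diagonal entry at `z ^ d` being the `r`-th
elementary symmetric function of the numbers `s_i q ^ μ_i`. It is also linear over `ℂ⟦p⟧`, and `μ =
0` holds only for powers of `p`.

Let `L` be a triangular `ℂ⟦p⟧`-linear operator whose diagonal entry `λ_d` differs from `λ_0` unless
`z ^ d` is a power of `p` (`IsNonresonant`). Then `L f = ε f` can be solved recursively: away from
the powers of `p` one divides by `λ_d - λ_0`, and at the powers of `p` the equation determines `ε`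
while the coefficient of `f` is free. Fixing these free coefficients gives one eigenfunction `f`;
all eigenfunctions whose eigenvalue has constant term `λ_0` lie in `ℂ⟦p⟧ f`. Hence `f` is an
eigenfunction of every `ℂ⟦p⟧`-linear operator that commutes with `L`.

The operator `𝓔^{(1)}` alone need not qualify, since `∑ s_i (q ^ μ_i - 1)` may vanish under the
given condition on `s`. The combination `L = ∑ u ^ r 𝓔^{(r)}` has diagonal entries `∏ (1 + s_i q ^
μ_i u) - 1`, and for generic `u` it is nonresonant exactly because `s_j / s_i` avoids nontrivial
powers of `q` (`exists_generatingEntry_ne`).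

What remains is commutativity. For `𝓔^{(1)}` and `𝓔^{(r)}` it reduces to a theta identity
(`sum_prod_phi`), an instance of elliptic partial fractions, which rest on the two-dimensionality of
a space of products of theta functions. Two arbitrary operators are handled by genericity: the
coefficients of the commutator, grouped by shift, do not involve `s`, and for generic `s` the
operator `𝓔^{(1)}` is itself nonresonant, so a joint eigenfunction exists. The commutator
annihilates it for generic `s`, which forces the grouped coefficients to vanish
(`sum_commCoeff_eq_zero`). -/

namespace Ruijsenaars

open PowerSeries

/-! ### Formal sums of powers of one variable -/

section FormalSum

variable {F : Type*} [Field F] {ι κ : Type*}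

/-- The power series `f` is the `X`-adically convergent sum `∑ i, w i * X ^ e i`. -/
def HasFormalSum (e : ι → ℕ) (w : ι → F) (f : F⟦X⟧) : Prop :=
  ∀ (N : ℕ) (s : Finset ι), (∀ i ∉ s, N ≤ e i) →
    (X : F⟦X⟧) ^ N ∣ f - ∑ i ∈ s, C (w i) * X ^ e i

/-- The power series `∑ i, w i * X ^ e i`, meaningful if only finitely many `i` have a given
exponent. -/
noncomputable def formalSum (e : ι → ℕ) (w : ι → F) : F⟦X⟧ :=
  PowerSeries.mk fun k => ∑ᶠ i, if e i = k then w i else 0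

theorem eq_of_forall_X_pow_dvd_sub {f g : F⟦X⟧} (h : ∀ N : ℕ, (X : F⟦X⟧) ^ N ∣ f - g) :
    f = g := by
  rw [← sub_eq_zero]
  ext k
  exact X_pow_dvd_iff.1 (h (k + 1)) k (Nat.lt_succ_self k)

theorem hasFormalSum_formalSum (e : ι → ℕ) (w : ι → F) :
    HasFormalSum e w (formalSum e w) := by
  classical
  intro N s hs
  rw [X_pow_dvd_iff]
  intro k hk
  rw [map_sub, sub_eq_zero, formalSum, coeff_mk, map_sum]
  rw [finsum_eq_sum_of_support_subset (s := s)]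
  · refine Finset.sum_congr rfl fun i _ => ?_
    rw [coeff_C_mul, coeff_X_pow]
    simp [eq_comm]
  · intro i hi
    by_contra his
    have := hs i his
    have hne : e i ≠ k := by omega
    simp [hne] at hi

/-- Two admissible truncations at level `N` differ only by terms of order at least `N`, so one
truncation per level suffices. -/
theorem HasFormalSum.of_exists {e : ι → ℕ} {w : ι → F} {f : F⟦X⟧}
    (h : ∀ N : ℕ, ∃ s : Finset ι, (∀ i ∉ s, N ≤ e i) ∧
      (X : F⟦X⟧) ^ N ∣ f - ∑ i ∈ s, C (w i) * X ^ e i) :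
    HasFormalSum e w f := by
  intro N s hs
  obtain ⟨s', hs', hd⟩ := h N
  have h1 := hasFormalSum_formalSum e w N s' hs'
  have h2 := hasFormalSum_formalSum e w N s hs
  have := dvd_add (dvd_sub hd h1) h2
  convert this using 1
  ring

theorem HasFormalSum.eq {e : ι → ℕ} {w : ι → F} {f g : F⟦X⟧}
    (he : ∀ N, {i | e i < N}.Finite)
    (hf : HasFormalSum e w f) (hg : HasFormalSum e w g) : f = g := by
  refine eq_of_forall_X_pow_dvd_sub fun N => ?_
  have hs : ∀ i ∉ (he N).toFinset, N ≤ e i := by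
    intro i hi
    simpa using hi
  have := dvd_sub (hf N _ hs) (hg N _ hs)
  convert this using 1
  ring

theorem HasFormalSum.mul {e : ι → ℕ} {w : ι → F} {f : F⟦X⟧} {e' : κ → ℕ} {w' : κ → F} {g : F⟦X⟧}
    (he : ∀ N, {i | e i < N}.Finite) (he' : ∀ N, {i | e' i < N}.Finite)
    (hf : HasFormalSum e w f) (hg : HasFormalSum e' w' g) :
    HasFormalSum (fun ij : ι × κ => e ij.1 + e' ij.2) (fun ij => w ij.1 * w' ij.2) (f * g) := by
  refine HasFormalSum.of_exists fun N => ⟨(he N).toFinset ×ˢ (he' N).toFinset, ?_, ?_⟩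
  · rintro ⟨i, j⟩ hij
    simp only [Finset.mem_product, Set.Finite.mem_toFinset, Set.mem_ofPred_eq, not_and_or,
      not_lt] at hij
    dsimp only
    omega
  · have h1 := hf N (he N).toFinset (by intro i hi; simpa using hi)
    have h2 := hg N (he' N).toFinset (by intro i hi; simpa using hi)
    have h3 : ∑ ij ∈ (he N).toFinset ×ˢ (he' N).toFinset,
        C (w ij.1 * w' ij.2) * (X : F⟦X⟧) ^ (e ij.1 + e' ij.2) =
        (∑ i ∈ (he N).toFinset, C (w i) * X ^ e i) *
          ∑ j ∈ (he' N).toFinset, C (w' j) * X ^ e' j := by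
      rw [Finset.sum_mul_sum, Finset.sum_product]
      refine Finset.sum_congr rfl fun i _ => Finset.sum_congr rfl fun j _ => ?_
      rw [map_mul, pow_add]
      ring
    rw [h3]
    have := dvd_add (h1.mul_right g) (h2.mul_left (∑ i ∈ (he N).toFinset, C (w i) * X ^ e i))
    convert this using 1
    ring

theorem HasFormalSum.comp_equiv {e : ι → ℕ} {w : ι → F} {f : F⟦X⟧} (σ : κ ≃ ι)
    (hf : HasFormalSum e w f) : HasFormalSum (e ∘ σ) (w ∘ σ) f := by
  intro N s hs
  have := hf N (s.map σ.toEmbedding) (by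
    intro i hi
    have := hs (σ.symm i) (by
      intro h
      exact hi (Finset.mem_map.2 ⟨_, h, σ.apply_symm_apply i⟩))
    simpa using this)
  simpa using this

theorem HasFormalSum.sumElim {e : ι → ℕ} {w : ι → F} {f : F⟦X⟧} {e' : κ → ℕ} {w' : κ → F}
    {g : F⟦X⟧} (hf : HasFormalSum e w f) (hg : HasFormalSum e' w' g) :
    HasFormalSum (Sum.elim e e') (Sum.elim w w') (f + g) := by
  intro N s hs
  have h1 := hf N s.toLeft (fun i hi => hs (Sum.inl i) (by simpa using hi))
  have h2 := hg N s.toRight (fun i hi => hs (Sum.inr i) (by simpa using hi))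
  have h3 : ∑ i ∈ s, C (Sum.elim w w' i) * (X : F⟦X⟧) ^ (Sum.elim e e' i) =
      (∑ i ∈ s.toLeft, C (w i) * X ^ e i) + ∑ j ∈ s.toRight, C (w' j) * X ^ e' j := by
    rw [Finset.sum_sum_eq_sum_toLeft_add_sum_toRight]
    simp
  rw [h3]
  convert dvd_add h1 h2 using 1
  ring

theorem HasFormalSum.C_mul {e : ι → ℕ} {w : ι → F} {f : F⟦X⟧} (c : F)
    (hf : HasFormalSum e w f) : HasFormalSum e (fun i => c * w i) (C c * f) := by
  intro N s hs
  convert (hf N s hs).mul_left (C c) using 1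
  rw [mul_sub, Finset.mul_sum]
  simp [mul_assoc]

end FormalSum

end Ruijsenaars

/-! ### The Jacobi theta series -/

namespace Ruijsenaars

open PowerSeries

section Jacobi

variable {F : Type*} [Field F]

/-- The triangular number `m (m - 1) / 2` for an integer `m`. -/
def tri (m : ℤ) : ℕ := (m * (m - 1) / 2).toNat

theorem two_mul_tri (m : ℤ) : 2 * (tri m : ℤ) = m * (m - 1) := by
  have h : Even (m * (m - 1)) := Int.even_mul_pred_self m
  obtain ⟨k, hk⟩ := h
  have hnn : 0 ≤ m * (m - 1) := by
    rcases le_or_gt m 0 with h | h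
    · exact mul_nonneg_of_nonpos_of_nonpos h (by omega)
    · exact mul_nonneg h.le (by omega)
  rw [tri, hk]
  omega

theorem abs_le_tri_add_one (m : ℤ) : |m| ≤ tri m + 1 := by
  have h := two_mul_tri m
  rcases abs_cases m with ⟨h1, h2⟩ | ⟨h1, h2⟩ <;> rw [h1] <;> nlinarith

theorem finite_setOf_lt_of_abs_le {e : ℤ → ℕ} (h : ∀ m, |m| ≤ e m + 1) (N : ℕ) :
    {m | e m < N}.Finite := by
  refine (Set.finite_Icc (-(N : ℤ)) N).subset fun m hm => ?_
  have h1 := h m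
  rw [Set.mem_ofPred_eq] at hm
  rw [abs_le] at h1
  rw [Set.mem_Icc]
  omega

theorem finite_setOf_tri_lt (N : ℕ) : {m | tri m < N}.Finite :=
  finite_setOf_lt_of_abs_le abs_le_tri_add_one N

/-- The Jacobi theta series `∑ m, (-1) ^ m * X ^ (m * (m - 1) / 2) * u ^ m`. -/
noncomputable def jac (u : Fˣ) : F⟦X⟧ :=
  formalSum tri fun m : ℤ => (((-u) ^ m : Fˣ) : F)

/-- The series `∑ k, X ^ e k * u ^ k`. -/
noncomputable def laurentSum (e : ℤ → ℕ) (u : Fˣ) : F⟦X⟧ :=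
  formalSum e fun k : ℤ => ((u ^ k : Fˣ) : F)

theorem hasFormalSum_jac (u : Fˣ) : HasFormalSum tri (fun m : ℤ => (((-u) ^ m : Fˣ) : F)) (jac u) :=
  hasFormalSum_formalSum _ _

/-- Pairs of integers, according to the parity of the difference. -/
def parityEquiv : (ℤ × ℤ) ⊕ (ℤ × ℤ) ≃ ℤ × ℤ where
  toFun := Sum.elim (fun kc => (kc.1 + kc.2, kc.1 - kc.2)) fun kc => (kc.1 + kc.2 + 1, kc.1 - kc.2)
  invFun ml := if (ml.1 - ml.2) % 2 = 0 then Sum.inl ((ml.1 + ml.2) / 2, (ml.1 - ml.2) / 2)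
    else Sum.inr ((ml.1 + ml.2 - 1) / 2, (ml.1 - ml.2 - 1) / 2)
  left_inv := by
    rintro (⟨k, c⟩ | ⟨k, c⟩)
    · have h : (k + c - (k - c)) % 2 = 0 := by omega
      simp only [Sum.elim_inl, h, if_true, Sum.inl.injEq, Prod.mk.injEq]
      omega
    · have h : ¬ (k + c + 1 - (k - c)) % 2 = 0 := by omega
      simp only [Sum.elim_inr, h, if_false, Sum.inr.injEq, Prod.mk.injEq]
      omega
  right_inv := by
    rintro ⟨m, l⟩
    by_cases h : (m - l) % 2 = 0
    · simp only [h, if_true, Sum.elim_inl, Prod.mk.injEq]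
      omega
    · simp only [h, if_false, Sum.elim_inr, Prod.mk.injEq]
      omega

/-- Substituting `(m, l) = (k + c, k - c)` or `(k + c + 1, k - c)`, according to the parity of `m -
l`, separates the quadratic exponent into a part in `k` and a part in `c`. The powers separate into
`u * v` and `u / v`. For `u = a / b₁`, `v = a / b₂` with `b₁ * b₂` fixed, `u * v` does not depend on
how the product is split and `u / v` is free of `a`; this is the source of `IsTheta.exists_span`. -/
theorem jac_mul_jac (u v : Fˣ) :
    jac u * jac v =
      laurentSum (fun k => 2 * tri k) (u * v) * laurentSum (fun c => c.natAbs ^ 2) (u / v) -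
        C (u : F) * (laurentSum (fun k => k.natAbs ^ 2) (u * v) *
          laurentSum (fun c => 2 * tri (c + 1)) (u / v)) := by
  have f1 : ∀ N, {m : ℤ | 2 * tri m < N}.Finite := finite_setOf_lt_of_abs_le fun m => by
    have := abs_le_tri_add_one m
    push_cast; omega
  have f2 : ∀ N, {m : ℤ | m.natAbs ^ 2 < N}.Finite := finite_setOf_lt_of_abs_le fun m => by
    rw [Int.abs_eq_natAbs]
    have := Nat.le_self_pow two_ne_zero m.natAbs
    exact_mod_cast this.trans (Nat.le_succ _)
  have f3 : ∀ N, {m : ℤ | 2 * tri (m + 1) < N}.Finite := finite_setOf_lt_of_abs_le fun m => by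
    have := two_mul_tri (m + 1)
    push_cast
    rw [this]
    rcases abs_cases m with ⟨h1, h2⟩ | ⟨h1, h2⟩ <;> rw [h1] <;> nlinarith
  have hfin := finite_setOf_tri_lt
  have hL := ((hasFormalSum_jac u).mul hfin hfin (hasFormalSum_jac v)).comp_equiv parityEquiv
  have hE := HasFormalSum.mul f1 f2
    (hasFormalSum_formalSum (fun k => 2 * tri k) fun k : ℤ => (((u * v) ^ k : Fˣ) : F))
    (hasFormalSum_formalSum (fun c => c.natAbs ^ 2) fun k : ℤ => (((u / v) ^ k : Fˣ) : F))
  have hO := HasFormalSum.C_mul (-(u : F)) (HasFormalSum.mul f2 f3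
    (hasFormalSum_formalSum (fun k => k.natAbs ^ 2) fun k : ℤ => (((u * v) ^ k : Fˣ) : F))
    (hasFormalSum_formalSum (fun c => 2 * tri (c + 1)) fun k : ℤ => (((u / v) ^ k : Fˣ) : F)))
  have hR := hE.sumElim hO
  have key := HasFormalSum.eq (f := jac u * jac v) ?_ hL (by
    convert hR using 1
    · funext x
      rcases x with ⟨k, c⟩ | ⟨k, c⟩
      · simp only [Function.comp, parityEquiv, Equiv.coe_fn_mk, Sum.elim_inl]
        zify
        have h1 := two_mul_tri (k + c)
        have h2 := two_mul_tri (k - c)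
        have h3 := two_mul_tri k
        rw [sq_abs]
        linarith
      · simp only [Function.comp, parityEquiv, Equiv.coe_fn_mk, Sum.elim_inr]
        zify
        have h1 := two_mul_tri (k + c + 1)
        have h2 := two_mul_tri (k - c)
        have h3 := two_mul_tri (c + 1)
        rw [sq_abs]
        linarith
    · funext x
      rcases x with ⟨k, c⟩ | ⟨k, c⟩
      · simp only [Function.comp, parityEquiv, Equiv.coe_fn_mk, Sum.elim_inl]
        rw [← Units.val_mul, ← Units.val_mul, Units.val_inj]
        rw [zpow_add, zpow_sub, ← div_eq_mul_inv, mul_div_assoc', mul_right_comm, mul_div_assoc,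
          ← mul_zpow, ← div_zpow, neg_mul_neg, neg_div_neg_eq]
      · simp only [Function.comp, parityEquiv, Equiv.coe_fn_mk, Sum.elim_inr]
        rw [← Units.val_neg, ← Units.val_mul, ← Units.val_mul, ← Units.val_mul, Units.val_inj]
        rw [zpow_add_one, zpow_add, zpow_sub, ← div_eq_mul_inv, mul_div_assoc',
          mul_right_comm _ (-u), mul_comm _ (-u), mul_right_comm, mul_div_assoc, mul_div_assoc,
          ← mul_zpow, ← div_zpow, neg_mul_neg, neg_div_neg_eq])
  · rw [key, laurentSum, laurentSum, laurentSum, laurentSum, map_neg]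
    ring
  · intro N
    refine (((hfin N).prod (hfin N)).preimage parityEquiv.injective.injOn).subset fun x hx => ?_
    simp only [Function.comp, Set.mem_ofPred_eq] at hx
    simp only [Set.mem_preimage, Set.mem_prod, Set.mem_ofPred_eq]
    omega

/-- The reflection `m ↦ 1 - m` preserves `m (m - 1) / 2`. -/
theorem jac_inv (u : Fˣ) : jac u⁻¹ = - C ((u⁻¹ : Fˣ) : F) * jac u := by
  have h1 := (hasFormalSum_jac u).comp_equiv (Equiv.subLeft (1 : ℤ))
  have h2 := (hasFormalSum_jac u⁻¹).C_mul (-(u : F))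
  have h3 : -C (u : F) * jac u⁻¹ = jac u := by
    refine HasFormalSum.eq (e := tri) finite_setOf_tri_lt (by rwa [map_neg] at h2) ?_
    convert h1 using 1
    · funext m
      have e1 := two_mul_tri m
      have e2 := two_mul_tri (1 - m)
      simp only [Function.comp, Equiv.subLeft_apply]
      zify
      linarith
    · funext m
      simp only [Function.comp, Equiv.subLeft_apply]
      rw [zpow_sub, zpow_one, Units.val_mul, Units.val_neg, ← inv_neg, inv_zpow]
  rw [← h3, ← mul_assoc, neg_mul_neg, ← map_mul, ← Units.val_mul]
  simp

theorem constantCoeff_jac (u : Fˣ) : constantCoeff (jac u) = 1 - (u : F) := by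
  have h := hasFormalSum_jac u 1 {0, 1} (by
    intro m hm
    have := two_mul_tri m
    by_contra h0
    have h0 : tri m = 0 := by omega
    rw [h0] at this
    have : m = 0 ∨ m - 1 = 0 := by simpa using this.symm
    simp at hm
    omega)
  rw [pow_one, X_dvd_iff] at h
  rw [map_sub, sub_eq_zero] at h
  rw [h]
  simp [show tri 0 = 0 from rfl, show tri 1 = 0 from rfl]
  ring

/-- The constant term `1 - u` already detects `u ≠ 1`; at `u = 1` the series equals its own negative
by `jac_inv`. -/
theorem jac_eq_zero_iff [CharZero F] (u : Fˣ) : jac u = 0 ↔ u = 1 := by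
  constructor
  · intro h
    have := constantCoeff_jac u
    rw [h, map_zero] at this
    exact Units.ext (sub_eq_zero.1 this.symm).symm
  · rintro rfl
    have := jac_inv (1 : Fˣ)
    rw [inv_one, Units.val_one, map_one, neg_one_mul] at this
    ext k
    have hk := congrArg (coeff k) this
    rw [map_neg] at hk
    exact self_eq_neg.1 hk

end Jacobi

end Ruijsenaars

/-! ### Gaussian binomial coefficients -/

namespace Ruijsenaars

open PowerSeries

section GaussBinomial

variable {A : Type*} [CommRing A]

/-- The Gaussian binomial coefficients in `p`. -/
def gaussBinom (p : A) : ℕ → ℕ → A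
  | _, 0 => 1
  | 0, _ + 1 => 0
  | M + 1, j + 1 => gaussBinom p M j + p ^ (j + 1) * gaussBinom p M (j + 1)

theorem gaussBinom_zero_right (p : A) (M : ℕ) : gaussBinom p M 0 = 1 := by
  cases M <;> rfl

theorem gaussBinom_succ_succ (p : A) (M j : ℕ) :
    gaussBinom p (M + 1) (j + 1) = gaussBinom p M j + p ^ (j + 1) * gaussBinom p M (j + 1) := rfl

theorem gaussBinom_eq_zero (p : A) {M j : ℕ} (h : M < j) : gaussBinom p M j = 0 := by
  induction M generalizing j with
  | zero =>
    obtain ⟨j, rfl⟩ := Nat.exists_eq_succ_of_ne_zero h.ne'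
    rfl
  | succ M ih =>
    obtain ⟨j, rfl⟩ := Nat.exists_eq_succ_of_ne_zero (by omega : j ≠ 0)
    rw [Nat.succ_eq_add_one, gaussBinom_succ_succ, ih (by omega), ih (by omega)]
    ring

/-- The `q`-binomial theorem. -/
theorem prod_add_pow_mul (p y w : A) (M : ℕ) :
    ∏ k ∈ Finset.range M, (y + p ^ k * w) =
      ∑ j ∈ Finset.range (M + 1), p ^ (j.choose 2) * gaussBinom p M j * w ^ j * y ^ (M - j) := by
  induction M generalizing w with
  | zero => simp [gaussBinom_zero_right]
  | succ M ih =>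
    have h1 : ∏ k ∈ Finset.range M, (y + p ^ (k + 1) * w) =
        ∏ k ∈ Finset.range M, (y + p ^ k * (p * w)) :=
      Finset.prod_congr rfl fun k _ => by ring
    rw [Finset.prod_range_succ', h1, ih, Finset.sum_range_succ' _ (M + 1), pow_zero, one_mul,
      mul_add, Finset.sum_mul, Finset.sum_mul]
    set g : ℕ → A := fun j =>
      p ^ (j.choose 2) * (p ^ j * gaussBinom p M j) * w ^ j * y ^ (M + 1 - j) with hg
    have h2 : ∑ j ∈ Finset.range (M + 1),
        p ^ (j.choose 2) * gaussBinom p M j * (p * w) ^ j * y ^ (M - j) * y =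
        ∑ j ∈ Finset.range (M + 1), g (j + 1) + g 0 := by
      rw [← Finset.sum_range_succ', Finset.sum_range_succ _ (M + 1)]
      have h0 : g (M + 1) = 0 := by simp [hg, gaussBinom_eq_zero p (Nat.lt_succ_self M)]
      rw [h0, add_zero]
      refine Finset.sum_congr rfl fun j hj => ?_
      have hj : j ≤ M := Nat.lt_succ_iff.1 (Finset.mem_range.1 hj)
      rw [hg]
      dsimp only
      rw [show M + 1 - j = M - j + 1 by omega]
      ring
    rw [h2, add_right_comm, ← Finset.sum_add_distrib]
    congr 1
    · refine Finset.sum_congr rfl fun j _ => ?_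
      rw [hg]
      dsimp only
      rw [gaussBinom_succ_succ, show (j + 1).choose 2 = j + j.choose 2 by
        rw [Nat.choose_succ_succ' j 1, Nat.choose_one_right], Nat.add_sub_add_right]
      ring
    · simp [hg, gaussBinom_zero_right]

theorem one_sub_pow_mul_gaussBinom_succ (p : A) {M j : ℕ} (h : j ≤ M) :
    (1 - p ^ (j + 1)) * gaussBinom p M (j + 1) = (1 - p ^ (M - j)) * gaussBinom p M j := by
  induction M generalizing j with
  | zero =>
    obtain rfl : j = 0 := by omega
    simp [gaussBinom]
  | succ M ih =>
    rcases h.eq_or_lt with rfl | h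
    · rw [gaussBinom_eq_zero p (Nat.lt_succ_self _)]
      simp
    obtain ⟨i, rfl⟩ := Nat.exists_eq_add_of_le (Nat.lt_succ_iff.1 h)
    cases j with
    | zero =>
      have := ih (Nat.zero_le _)
      rw [gaussBinom_succ_succ, gaussBinom_zero_right, gaussBinom_zero_right]
      rw [gaussBinom_zero_right] at this
      simp only [zero_add, Nat.sub_zero, pow_succ] at this ⊢
      linear_combination p * this
    | succ j =>
      have h1 := ih (j := j) (by omega)
      have h2 := ih (j := j + 1) (by omega)
      rw [gaussBinom_succ_succ, gaussBinom_succ_succ p _ j]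
      rw [show j + 1 + i - j = i + 1 by omega] at h1
      rw [show j + 1 + i - (j + 1) = i by omega] at h2
      rw [show j + 1 + i + 1 - (j + 1) = i + 1 by omega]
      linear_combination p ^ (j + 2) * h2 + h1

/-- The finite product `(p; p)_m`. -/
def eulerProd (p : A) (m : ℕ) : A := ∏ k ∈ Finset.range m, (1 - p ^ (k + 1))

theorem gaussBinom_mul_eulerProd (p : A) (i j : ℕ) :
    gaussBinom p (i + j) j * (eulerProd p j * eulerProd p i) = eulerProd p (i + j) := by
  induction j generalizing i with
  | zero => simp [gaussBinom_zero_right, eulerProd]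
  | succ j ih =>
    have h1 := one_sub_pow_mul_gaussBinom_succ p (M := i + 1 + j) (j := j) (by omega)
    rw [show i + 1 + j - j = i + 1 by omega] at h1
    have h2 := ih (i + 1)
    rw [show i + (j + 1) = i + 1 + j by omega, ← h2]
    have e1 : eulerProd p (j + 1) = eulerProd p j * (1 - p ^ (j + 1)) :=
      Finset.prod_range_succ _ _
    have e2 : eulerProd p (i + 1) = eulerProd p i * (1 - p ^ (i + 1)) :=
      Finset.prod_range_succ _ _
    rw [e1, e2]
    linear_combination (eulerProd p j * eulerProd p i) * h1

theorem dvd_eulerProd_sub (p : A) {m m' : ℕ} (h : m ≤ m') :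
    p ^ (m + 1) ∣ eulerProd p m' - eulerProd p m := by
  induction m', h using Nat.le_induction with
  | base => simp
  | succ k hk ih =>
    have e1 : eulerProd p (k + 1) = eulerProd p k * (1 - p ^ (k + 1)) :=
      Finset.prod_range_succ _ _
    have : p ^ (m + 1) ∣ eulerProd p k * p ^ (k + 1) :=
      (pow_dvd_pow p (by omega)).mul_left _
    rw [e1]
    convert dvd_sub ih this using 1
    ring

end GaussBinomial

/-! ### The Jacobi triple product, truncated -/

section TripleProduct

variable {F : Type*} [Field F]

theorem isUnit_eulerProd_X (m : ℕ) : IsUnit (eulerProd (X : F⟦X⟧) m) := by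
  rw [PowerSeries.isUnit_iff_constantCoeff, eulerProd, map_prod]
  simp

/-- The product is `(p;p)_N (p;p)_{2N} / ((p;p)_i (p;p)_j)`. Pairing `N` with the smaller of `i`,
`j` and `2N` with the larger, each quotient is `1` up to order `min i j + 1`. -/
theorem X_pow_dvd_eulerProd_mul_gaussBinom_sub_one (i j N : ℕ) (hN : i + j = 2 * N) {l : ℕ}
    (hi : l ≤ i + 1) (hj : l ≤ j + 1) :
    (X : F⟦X⟧) ^ l ∣ eulerProd X N * gaussBinom X (i + j) j - 1 := by
  have h0 := gaussBinom_mul_eulerProd (X : F⟦X⟧) i j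
  have key : ∀ i j : ℕ, i + j = 2 * N → l ≤ i + 1 → i ≤ j → (X : F⟦X⟧) ^ l ∣
      eulerProd X N * eulerProd X (i + j) - eulerProd X j * eulerProd X i := by
    intro i j hN hi hij
    have h1 := dvd_eulerProd_sub (X : F⟦X⟧) (m := i) (m' := N) (by omega)
    have h2 := dvd_eulerProd_sub (X : F⟦X⟧) (m := j) (m' := i + j) (by omega)
    have h3 : (X : F⟦X⟧) ^ l ∣ eulerProd X N - eulerProd X i := (pow_dvd_pow X hi).trans h1
    have h4 : (X : F⟦X⟧) ^ l ∣ eulerProd X (i + j) - eulerProd X j :=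
      (pow_dvd_pow X (by omega)).trans h2
    convert dvd_add (h3.mul_right (eulerProd X (i + j))) (h4.mul_right (eulerProd X i)) using 1
    ring
  have key' : (X : F⟦X⟧) ^ l ∣
      eulerProd X N * eulerProd X (i + j) - eulerProd X j * eulerProd X i := by
    rcases le_total i j with h | h
    · exact key i j hN hi h
    · have := key j i (by omega) hj h
      rwa [add_comm j i, mul_comm (eulerProd X i)] at this
  have hu : IsUnit (eulerProd (X : F⟦X⟧) j * eulerProd X i) :=
    (isUnit_eulerProd_X j).mul (isUnit_eulerProd_X i)
  rw [← hu.dvd_mul_right]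
  convert key' using 1
  rw [← h0]
  ring

/-- The truncated product form of the theta function. -/
noncomputable def thetaProd (u : Fˣ) (N : ℕ) : F⟦X⟧ :=
  (∏ k ∈ Finset.range N, (1 - X ^ k * C (u : F))) *
    ∏ k ∈ Finset.range N, (1 - X ^ k * (X * C ((u⁻¹ : Fˣ) : F)))

theorem thetaProd_eq_sum (u : Fˣ) (N : ℕ) :
    thetaProd u N = ∑ j ∈ Finset.range (2 * N + 1),
      gaussBinom X (2 * N) j * (C (((-u) ^ ((j : ℤ) - N) : Fˣ) : F) * X ^ tri ((j : ℤ) - N)) := by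
  -- The choice `y = X ^ N` with `2 * N` factors clears the negative powers of `X`: the first `N`
  -- factors give the product in `u⁻¹`, the last `N` the product in `u`, up to the monomial that is
  -- cancelled below.
  have h := prod_add_pow_mul (X : F⟦X⟧) (X ^ N) (C (((-u : Fˣ)) : F)) (2 * N)
  have hUV : C (u : F) * C ((u⁻¹ : Fˣ) : F) = 1 := by rw [← map_mul]; simp
  have hL : ∏ k ∈ Finset.range (2 * N), ((X : F⟦X⟧) ^ N + X ^ k * C (((-u : Fˣ)) : F)) =
      C (((-u : Fˣ)) : F) ^ N * X ^ (N.choose 2 + N * N) * thetaProd u N := by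
    rw [two_mul, Finset.prod_range_add]
    have h1 : ∏ k ∈ Finset.range N, ((X : F⟦X⟧) ^ N + X ^ (N + k) * C (((-u : Fˣ)) : F)) =
        X ^ (N * N) * ∏ k ∈ Finset.range N, (1 - X ^ k * C (u : F)) := by
      have : ∀ k ∈ Finset.range N, (X : F⟦X⟧) ^ N + X ^ (N + k) * C (((-u : Fˣ)) : F) =
          X ^ N * (1 - X ^ k * C (u : F)) := fun k _ => by
        rw [Units.val_neg, map_neg]
        ring
      rw [Finset.prod_congr rfl this, Finset.prod_mul_distrib, Finset.prod_const,
        Finset.card_range, pow_mul]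
    have h2 : ∏ k ∈ Finset.range N, ((X : F⟦X⟧) ^ N + X ^ k * C (((-u : Fˣ)) : F)) =
        C (((-u : Fˣ)) : F) ^ N * X ^ (N.choose 2) *
          ∏ k ∈ Finset.range N, (1 - X ^ k * (X * C ((u⁻¹ : Fˣ) : F))) := by
      have : ∀ k ∈ Finset.range N, (X : F⟦X⟧) ^ N + X ^ k * C (((-u : Fˣ)) : F) =
          C (((-u : Fˣ)) : F) * X ^ k *
            (1 - X ^ (N - 1 - k) * (X * C ((u⁻¹ : Fˣ) : F))) := fun k hk => by
        have hk := Finset.mem_range.1 hk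
        have hX : (X : F⟦X⟧) ^ N = X ^ k * X ^ (N - 1 - k) * X := by
          rw [← pow_add, ← pow_succ]
          congr 1
          omega
        rw [Units.val_neg, map_neg, hX]
        linear_combination (-(X : F⟦X⟧) ^ k * X ^ (N - 1 - k) * X) * hUV
      rw [Finset.prod_congr rfl this, Finset.prod_mul_distrib, Finset.prod_mul_distrib,
        Finset.prod_const, Finset.card_range, Finset.prod_pow_eq_pow_sum, Finset.sum_range_id,
        Nat.choose_two_right]
      congr 1
      exact Finset.prod_range_reflect
        (fun k => 1 - (X : F⟦X⟧) ^ k * (X * C ((u⁻¹ : Fˣ) : F))) N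
    rw [h1, h2, thetaProd]
    ring
  have hne : C (((-u : Fˣ)) : F) ^ N * (X : F⟦X⟧) ^ (N.choose 2 + N * N) ≠ 0 := by
    refine mul_ne_zero (pow_ne_zero _ ?_) (pow_ne_zero _ X_ne_zero)
    exact (map_ne_zero_iff _ C_injective).2 (-u).ne_zero
  apply mul_left_cancel₀ hne
  rw [← hL, h, Finset.mul_sum]
  refine Finset.sum_congr rfl fun j hj => ?_
  have hj := Nat.lt_succ_iff.1 (Finset.mem_range.1 hj)
  have e1 : C (((-u : Fˣ)) : F) ^ j =
      C (((-u : Fˣ)) : F) ^ N * C (((-u) ^ ((j : ℤ) - N) : Fˣ) : F) := by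
    rw [← map_pow, ← map_pow, ← map_mul, ← Units.val_pow_eq_pow_val, ← Units.val_pow_eq_pow_val,
      ← Units.val_mul, ← zpow_natCast, ← zpow_natCast, ← zpow_add]
    congr 4
    ring
  have e2 : j.choose 2 + N * (2 * N - j) = N.choose 2 + N * N + tri ((j : ℤ) - N) := by
    have t1 := two_mul_tri ((j : ℤ) - N)
    have t2 : ∀ k : ℕ, 2 * (k.choose 2 : ℤ) = k * (k - 1) := fun k => by
      rcases k with _ | k
      · simp
      · have h := Nat.choose_two_right (k + 1)
        have h' := Nat.even_mul_succ_self k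
        rw [Nat.add_sub_cancel, mul_comm] at h
        obtain ⟨c, hc⟩ := h'
        rw [hc] at h
        have : (k : ℤ) * (k + 1) = c + c := by exact_mod_cast hc
        push_cast
        have h4 : (k + 1).choose 2 = c := by omega
        rw [h4]
        linarith
    have t3 := t2 j
    have t4 := t2 N
    have : ((2 * N - j : ℕ) : ℤ) = 2 * N - j := by
      push_cast [Nat.cast_sub hj]
      ring
    zify
    rw [this]
    linarith
  have e3 : (X : F⟦X⟧) ^ j.choose 2 * (X ^ N) ^ (2 * N - j) =
      X ^ (N.choose 2 + N * N) * X ^ tri ((j : ℤ) - N) := by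
    rw [← pow_mul, ← pow_add, ← pow_add, e2]
  rw [e1]
  linear_combination (gaussBinom X (2 * N) j * C (((-u : Fˣ)) : F) ^ N *
    C (((-u) ^ ((j : ℤ) - N) : Fˣ) : F)) * e3

/-- A finite form of the triple product identity. Far from the middle the Gaussian binomial is a
poor approximation, but there the triangular exponent is large. -/
theorem X_pow_dvd_eulerProd_mul_thetaProd_sub_jac (u : Fˣ) (N : ℕ) :
    X ^ N ∣ eulerProd X N * thetaProd u N - jac u := by
  have h1 : (X : F⟦X⟧) ^ N ∣ jac u - ∑ j ∈ Finset.range (2 * N + 1),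
      C (((-u) ^ ((j : ℤ) - N) : Fˣ) : F) * X ^ tri ((j : ℤ) - N) := by
    have := hasFormalSum_jac u N ((Finset.range (2 * N + 1)).image fun j : ℕ => (j : ℤ) - N) (by
      intro m hm
      have h2 := abs_le_tri_add_one m
      rw [abs_le] at h2
      by_contra h3
      apply hm
      rw [Finset.mem_image]
      refine ⟨(m + N).toNat, Finset.mem_range.2 (by omega), by omega⟩)
    rwa [Finset.sum_image fun a _ b _ h => by simpa using h] at this
  have h2 : (X : F⟦X⟧) ^ N ∣ ∑ j ∈ Finset.range (2 * N + 1),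
      (eulerProd X N * gaussBinom X (2 * N) j - 1) *
        (C (((-u) ^ ((j : ℤ) - N) : Fˣ) : F) * X ^ tri ((j : ℤ) - N)) := by
    refine Finset.dvd_sum fun j hj => ?_
    have hj := Finset.mem_range.1 hj
    have ht := abs_le_tri_add_one ((j : ℤ) - N)
    obtain ⟨i, hi⟩ := Nat.exists_eq_add_of_le (Nat.lt_succ_iff.1 hj)
    have h3 := X_pow_dvd_eulerProd_mul_gaussBinom_sub_one (F := F) i j N (by omega)
      (l := min (i + 1) (j + 1)) (min_le_left _ _) (min_le_right _ _)
    rw [show i + j = 2 * N by omega] at h3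
    have h4 : (X : F⟦X⟧) ^ (min (i + 1) (j + 1) + tri ((j : ℤ) - N)) ∣
        (eulerProd X N * gaussBinom X (2 * N) j - 1) *
        (C (((-u) ^ ((j : ℤ) - N) : Fˣ) : F) * X ^ tri ((j : ℤ) - N)) := by
      rw [pow_add]
      exact mul_dvd_mul h3 (Dvd.intro_left _ rfl)
    -- Since `min i j = N - |j - N|` and `tri (j - N) ≥ |j - N| - 1`, the two orders add up to at
    -- least `N`.
    refine (pow_dvd_pow X ?_).trans h4
    rw [abs_le] at ht
    omega
  rw [thetaProd_eq_sum]
  convert dvd_sub h2 h1 using 1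
  simp only [sub_mul, Finset.sum_sub_distrib, one_mul, Finset.mul_sum, mul_assoc]
  ring

end TripleProduct

end Ruijsenaars

/-! ### Elliptic partial fractions -/

namespace Ruijsenaars

section PartialFraction

variable {G K ι : Type*} [CommGroup G] [Field K]

/-- The properties of a theta function on a group that elliptic partial fractions rest on:
it vanishes only at `1`, it is quasi-symmetric under inversion, and the functions
`a ↦ θ (a / b₁) θ (a / b₂)` with a given product `b₁ b₂` span a space of dimension at most two. -/
structure IsTheta (χ : G →* Kˣ) (th : G → K) : Prop where
  eq_zero_iff : ∀ u, th u = 0 ↔ u = 1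
  map_inv : ∀ u, th u⁻¹ = -χ u⁻¹ * th u
  exists_span : ∀ B : G, ∃ e₀ e₁ : G → K, ∀ b₁ b₂, b₁ * b₂ = B →
    ∃ l m : K, ∀ a, th (a / b₁) * th (a / b₂) = l * e₀ a + m * e₁ a

variable {χ : G →* Kˣ} {th : G → K}

/-- The addition formula: `θ (x / b₁) θ (x / b₂)` is a combination of two such products with
prescribed zeros `a₁` and `a₂`. -/
theorem IsTheta.exists_addition (h : IsTheta χ th) {a₁ a₂ b₁ b₂ : G} (h12 : a₁ ≠ a₂)
    (hab : a₁ * a₂ ≠ b₁ * b₂) :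
    ∃ α β : K, ∀ x, th (x / b₁) * th (x / b₂) =
      α * (th (x / a₁) * th (x / (b₁ * b₂ / a₁))) +
        β * (th (x / a₂) * th (x / (b₁ * b₂ / a₂))) := by
  obtain ⟨e₀, e₁, he⟩ := h.exists_span (b₁ * b₂)
  obtain ⟨l, m, hb⟩ := he b₁ b₂ rfl
  obtain ⟨l₁, m₁, h₁⟩ := he a₁ (b₁ * b₂ / a₁) (mul_div_cancel _ _)
  obtain ⟨l₂, m₂, h₂⟩ := he a₂ (b₁ * b₂ / a₂) (mul_div_cancel _ _)
  have hone : th 1 = 0 := (h.eq_zero_iff 1).2 rfl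
  have z₁ : l₁ * e₀ a₁ + m₁ * e₁ a₁ = 0 := by rw [← h₁, div_self', hone, zero_mul]
  have n₁ : l₂ * e₀ a₁ + m₂ * e₁ a₁ ≠ 0 := by
    rw [← h₂]
    refine mul_ne_zero (fun h0 => ?_) fun h0 => ?_
    · exact h12 (div_eq_one.1 ((h.eq_zero_iff _).1 h0))
    · rw [h.eq_zero_iff, div_eq_one, eq_div_iff_mul_eq'] at h0
      exact hab h0
  have n₂ : l₁ * e₀ a₂ + m₁ * e₁ a₂ ≠ 0 := by
    rw [← h₁]
    refine mul_ne_zero (fun h0 => ?_) fun h0 => ?_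
    · exact h12 (div_eq_one.1 ((h.eq_zero_iff _).1 h0)).symm
    · rw [h.eq_zero_iff, div_eq_one, eq_div_iff_mul_eq', mul_comm] at h0
      exact hab h0
  -- The two products are linearly independent: the first vanishes at `a₁`, where the second does
  -- not. Hence they span the space, and Cramer's rule gives `α` and `β`.
  have hdet : l₁ * m₂ - l₂ * m₁ ≠ 0 := by
    intro h0
    refine mul_ne_zero n₁ n₂ ?_
    linear_combination (e₀ a₂ * l₂ + m₂ * e₁ a₂) * z₁ +
      (e₀ a₂ * e₁ a₁ - e₀ a₁ * e₁ a₂) * h0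
  refine ⟨(l * m₂ - m * l₂) / (l₁ * m₂ - l₂ * m₁), (l₁ * m - m₁ * l) / (l₁ * m₂ - l₂ * m₁),
    fun x => ?_⟩
  rw [hb, h₁, h₂, div_mul_eq_mul_div, div_mul_eq_mul_div, ← add_div, eq_div_iff hdet]
  ring

/-- The elliptic partial fraction identity. -/
theorem IsTheta.sum_eq_zero [DecidableEq ι] (h : IsTheta χ th) (a : ι → G) (S : Finset ι)
    (ha : Set.InjOn a S) (B : Multiset G) (hB : B.card = S.card) (hS : 2 ≤ S.card)
    (hprod : B.prod = ∏ i ∈ S, a i) :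
    ∑ i ∈ S, (B.map fun b => th (a i / b)).prod / ∏ j ∈ S.erase i, th (a i / a j) = 0 := by
  obtain ⟨N, hN⟩ := Nat.exists_eq_add_of_le hS
  induction N generalizing S B with
  | zero =>
    obtain ⟨i, j, hij, rfl⟩ := Finset.card_eq_two.1 (by omega : S.card = 2)
    obtain ⟨b₁, b₂, rfl⟩ := Multiset.card_eq_two.1 (hB.trans hN)
    have hne : a i ≠ a j := fun h0 => hij (ha (by simp) (by simp) h0)
    have hp : b₁ * b₂ = a i * a j := by simpa [Finset.prod_pair hij] using hprod
    have e1 : ({i, j} : Finset ι).erase i = {j} := by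
      ext k; simp only [Finset.mem_erase, Finset.mem_insert, Finset.mem_singleton]; grind
    have e2 : ({i, j} : Finset ι).erase j = {i} := by
      ext k; simp only [Finset.mem_erase, Finset.mem_insert, Finset.mem_singleton]; grind
    rw [Finset.sum_pair hij, e1, e2, Finset.prod_singleton, Finset.prod_singleton]
    simp only [Multiset.insert_eq_cons, Multiset.map_cons, Multiset.map_singleton,
      Multiset.prod_cons, Multiset.prod_singleton]
    -- With two points, `b₁ * b₂ = a i * a j` makes all arguments of the second term inverse to
    -- those of the first, so quasi-symmetry makes the terms cancel.
    have s1 : a j / b₁ = (a i / b₂)⁻¹ := by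
      rw [inv_div, div_eq_div_iff_mul_eq_mul, mul_comm (a j), ← hp, mul_comm]
    have s2 : a j / b₂ = (a i / b₁)⁻¹ := by
      rw [inv_div, div_eq_div_iff_mul_eq_mul, mul_comm (a j), ← hp]
    have s3 : a j / a i = (a i / a j)⁻¹ := (inv_div _ _).symm
    have hχ : χ (a i / b₂)⁻¹ * χ (a i / b₁)⁻¹ = χ (a i / a j)⁻¹ := by
      rw [← map_mul]
      congr 1
      rw [inv_div, inv_div, inv_div, div_mul_div_comm, mul_comm b₂, hp, mul_div_mul_left_eq_div]
    have hχ' := congrArg Units.val hχ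
    rw [Units.val_mul] at hχ'
    have hn : th (a i / a j) ≠ 0 := fun h0 => hne (div_eq_one.1 ((h.eq_zero_iff _).1 h0))
    rw [s1, s2, s3, h.map_inv, h.map_inv, h.map_inv]
    have hu := (χ (a i / a j)⁻¹).ne_zero
    field_simp
    linear_combination (-th (a i / b₁) * th (a i / b₂)) * hχ'
  | succ N ih =>
    obtain ⟨i₀, hi₀, i₁, hi₁, i₂, hi₂, h01, h02, h12⟩ := Finset.two_lt_card.1
      (by omega : 2 < S.card)
    obtain ⟨b₁, B₁, rfl⟩ := Multiset.card_pos_iff_exists_mem.1 (by omega : 0 < B.card) |>.imp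
      fun _ hb => Multiset.exists_cons_of_mem hb
    rw [Multiset.card_cons] at hB
    obtain ⟨b₂, B', rfl⟩ := Multiset.card_pos_iff_exists_mem.1 (by omega : 0 < B₁.card) |>.imp
      fun _ hb => Multiset.exists_cons_of_mem hb
    rw [Multiset.card_cons] at hB
    rw [Multiset.prod_cons, Multiset.prod_cons] at hprod
    -- The addition formula needs `a k * a l ≠ b₁ * b₂`. Among three points the products `a i₀ * a
    -- i₁` and `a i₀ * a i₂` differ, so one of the pairs qualifies.
    obtain ⟨k, l, hk, hl, hkl, hne⟩ : ∃ k l, k ∈ S ∧ l ∈ S ∧ k ≠ l ∧ a k * a l ≠ b₁ * b₂ := by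
      by_cases h0 : a i₀ * a i₁ = b₁ * b₂
      · refine ⟨i₀, i₂, hi₀, hi₂, h02, fun h3 => h12 (ha hi₁ hi₂ ?_)⟩
        exact mul_left_cancel (h0.trans h3.symm)
      · exact ⟨i₀, i₁, hi₀, hi₁, h01, h0⟩
    obtain ⟨α, β, hαβ⟩ := h.exists_addition (fun h0 => hkl (ha hk hl h0)) hne
    -- When a numerator zero sits at `a m`, the term `i = m` drops out and `th (a i / a m)` cancels
    -- elsewhere. This leaves the identity for `S.erase m`.
    have key : ∀ m ∈ S, ∑ i ∈ S, th (a i / a m) * th (a i / (b₁ * b₂ / a m)) *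
        (B'.map fun b => th (a i / b)).prod / ∏ j ∈ S.erase i, th (a i / a j) = 0 := by
      intro m hm
      have hcard := Finset.card_erase_of_mem hm
      have := ih (S.erase m) (ha.mono (by simp)) ((b₁ * b₂ / a m) ::ₘ B')
        (by rw [Multiset.card_cons]; omega) (by omega) (by
          rw [Multiset.prod_cons]
          apply mul_left_cancel (a := a m)
          rw [Finset.mul_prod_erase S a hm, ← hprod]
          rw [← mul_assoc, mul_div_cancel, mul_assoc]) (by omega)
      rw [← Finset.add_sum_erase S _ hm, div_self', (h.eq_zero_iff 1).2 rfl, zero_mul, zero_mul,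
        zero_div, zero_add, ← this]
      refine Finset.sum_congr rfl fun i hi => ?_
      have him := Finset.ne_of_mem_erase hi
      have hiS := Finset.mem_of_mem_erase hi
      have hn : th (a i / a m) ≠ 0 :=
        fun h0 => him (ha hiS hm (div_eq_one.1 ((h.eq_zero_iff _).1 h0)))
      rw [Finset.erase_right_comm, ← Finset.mul_prod_erase (S.erase i) (fun j => th (a i / a j))
        (Finset.mem_erase.2 ⟨him.symm, hm⟩), Multiset.map_cons, Multiset.prod_cons, mul_assoc,
        mul_div_mul_left _ _ hn]
    have e : ∀ i ∈ S, ((b₁ ::ₘ b₂ ::ₘ B').map fun b => th (a i / b)).prod /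
        ∏ j ∈ S.erase i, th (a i / a j) =
        α * (th (a i / a k) * th (a i / (b₁ * b₂ / a k)) *
        (B'.map fun b => th (a i / b)).prod / ∏ j ∈ S.erase i, th (a i / a j)) +
        β * (th (a i / a l) * th (a i / (b₁ * b₂ / a l)) *
        (B'.map fun b => th (a i / b)).prod / ∏ j ∈ S.erase i, th (a i / a j)) := by
      intro i _
      rw [Multiset.map_cons, Multiset.prod_cons, Multiset.map_cons, Multiset.prod_cons,
        ← mul_assoc, hαβ]
      ring
    rw [Finset.sum_congr rfl e, Finset.sum_add_distrib, ← Finset.mul_sum, ← Finset.mul_sum,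
      key k hk, key l hl]
    ring

theorem IsTheta.ne_zero (h : IsTheta χ th) {u : G} (hu : u ≠ 1) : th u ≠ 0 :=
  fun h0 => hu ((h.eq_zero_iff u).1 h0)

/-- The elliptic function `θ (t v) θ (q v / t) / (θ v θ (q v))`. -/
def thetaQuotient (th : G → K) (q t v : G) : K :=
  th (t * v) * th (q / t * v) / (th v * th (q * v))

/-- The quasi-symmetry factors cancel because the arguments in numerator and denominator have the
same product `q * v * v`. -/
theorem IsTheta.thetaQuotient_inv (h : IsTheta χ th) (q t v : G) :
    th (q / t * v)⁻¹ * th (t * v)⁻¹ / (th v⁻¹ * th (q * v)⁻¹) = thetaQuotient th q t v := by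
  have hχ : ((χ (q / t * v)⁻¹ : Kˣ) : K) * χ (t * v)⁻¹ = χ v⁻¹ * χ (q * v)⁻¹ := by
    rw [← Units.val_mul, ← Units.val_mul, ← map_mul, ← map_mul, ← mul_inv, ← mul_inv]
    rw [mul_mul_mul_comm, div_mul_cancel, mul_left_comm v]
  have hu : ((χ v⁻¹ : Kˣ) : K) * χ (q * v)⁻¹ ≠ 0 :=
    mul_ne_zero (Units.ne_zero _) (Units.ne_zero _)
  rw [h.map_inv, h.map_inv, h.map_inv, h.map_inv, thetaQuotient, mul_mul_mul_comm,
    mul_mul_mul_comm (-((χ v⁻¹ : Kˣ) : K)), neg_mul_neg, neg_mul_neg, hχ, mul_div_mul_left _ _ hu,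
    mul_comm (th (q / t * v))]

/-- Partial fractions at the `2 |D|` points `x i` and `x i / q`, with numerator zeros `x j / t` and
`t * x j / q`. The first kind of point yields the left side, the second kind minus the right side,
both times `th t * th (q / t) / th q`. -/
theorem IsTheta.sum_prod_thetaQuotient [DecidableEq ι] (h : IsTheta χ th) {q : G} (t : G)
    (hq : q ≠ 1) (x : ι → G) (D : Finset ι) (hx : ∀ i ∈ D, ∀ j ∈ D, i ≠ j → x i ≠ x j)
    (hqx : ∀ i ∈ D, ∀ j ∈ D, i ≠ j → q * x i ≠ x j) :
    ∑ i ∈ D, ∏ j ∈ D.erase i, thetaQuotient th q t (x i / x j) =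
      ∑ i ∈ D, ∏ j ∈ D.erase i, thetaQuotient th q t (x j / x i) := by
  have hne : ∀ i ∈ D, ∀ j ∈ D, i ≠ j → th (x i / x j) ≠ 0 := fun i hi j hj hij =>
    h.ne_zero fun h0 => hx i hi j hj hij (div_eq_one.1 h0)
  have hqne : ∀ i ∈ D, ∀ j ∈ D, i ≠ j → th (q * (x i / x j)) ≠ 0 := fun i hi j hj hij =>
    h.ne_zero fun h0 => hqx i hi j hj hij (div_eq_one.1 (by rwa [mul_div_assoc]))
  have htriv : (∀ i ∈ D, ∀ j ∈ D, i ≠ j → thetaQuotient th q t (x i / x j) = 1) →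
      ∑ i ∈ D, ∏ j ∈ D.erase i, thetaQuotient th q t (x i / x j) =
      ∑ i ∈ D, ∏ j ∈ D.erase i, thetaQuotient th q t (x j / x i) := fun h1 => by
    refine Finset.sum_congr rfl fun i hi => Finset.prod_congr rfl fun j hj => ?_
    rw [Finset.mem_erase] at hj
    rw [h1 i hi j hj.2 hj.1.symm, h1 j hj.2 i hi hj.1]
  -- For `t = 1` or `t = q` the common constant vanishes and cannot be cancelled, but then every
  -- quotient is `1`.
  by_cases ht1 : t = 1
  · refine htriv fun i hi j hj hij => ?_
    rw [thetaQuotient, ht1, one_mul, div_one]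
    exact div_self (mul_ne_zero (hne i hi j hj hij) (hqne i hi j hj hij))
  by_cases htq : t = q
  · refine htriv fun i hi j hj hij => ?_
    rw [thetaQuotient, htq, div_self', one_mul, mul_comm]
    exact div_self (mul_ne_zero (hne i hi j hj hij) (hqne i hi j hj hij))
  rcases D.eq_empty_or_nonempty with rfl | hD
  · simp
  set a : ι ⊕ ι → G := Sum.elim x fun i => x i / q with ha
  set B : Multiset G := (D.val.map fun j => x j / t) + D.val.map fun j => t / q * x j with hB
  have hcard : (D.disjSum D).card = 2 * D.card := by rw [Finset.card_disjSum, two_mul]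
  have hinj : Set.InjOn a (D.disjSum D : Finset (ι ⊕ ι)) := by
    rintro (i | i) hi (j | j) hj hij <;>
      simp only [Finset.mem_coe, Finset.inl_mem_disjSum, Finset.inr_mem_disjSum] at hi hj <;>
      simp only [ha, Sum.elim_inl, Sum.elim_inr] at hij
    · by_contra hne'
      exact hx i hi j hj (fun h0 => hne' (by rw [h0])) hij
    · exfalso
      rw [eq_div_iff_mul_eq', mul_comm] at hij
      by_cases h0 : i = j
      · subst h0
        exact hq (mul_eq_right.1 hij)
      · exact hqx i hi j hj h0 hij
    · exfalso
      rw [div_eq_iff_eq_mul, mul_comm] at hij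
      by_cases h0 : i = j
      · subst h0
        exact hq (mul_eq_right.1 hij.symm)
      · exact hqx j hj i hi (Ne.symm h0) hij.symm
    · by_contra hne'
      exact hx i hi j hj (fun h0 => hne' (by rw [h0])) (div_left_injective hij)
  have key := h.sum_eq_zero a (D.disjSum D) hinj B (by rw [hcard, hB]; simp [two_mul])
    (by have := hD.card_pos; omega) (by
      rw [hB, Multiset.prod_add, Finset.prod_disjSum]
      change (∏ j ∈ D, x j / t) * (∏ j ∈ D, t / q * x j) = (∏ j ∈ D, x j) * ∏ j ∈ D, x j / q
      rw [← Finset.prod_mul_distrib, ← Finset.prod_mul_distrib]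
      refine Finset.prod_congr rfl fun j _ => ?_
      rw [← mul_assoc, ← mul_div_assoc, div_mul_cancel, mul_comm])
  rw [Finset.sum_disjSum] at key
  set c : K := th t * th (q / t) / th q with hc
  have hc0 : c ≠ 0 := div_ne_zero (mul_ne_zero (h.ne_zero ht1)
    (h.ne_zero fun h0 => htq (div_eq_one.1 h0).symm)) (h.ne_zero hq)
  have hmap : ∀ y : G, (B.map fun b => th (y / b)).prod =
      (∏ j ∈ D, th (y / (x j / t))) * ∏ j ∈ D, th (y / (t / q * x j)) := fun y => by
    rw [hB, Multiset.map_add, Multiset.prod_add, Multiset.map_map, Multiset.map_map]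
    rfl
  have e1 : ∀ i ∈ D, (B.map fun b => th (a (Sum.inl i) / b)).prod /
      ∏ j ∈ (D.disjSum D).erase (Sum.inl i), th (a (Sum.inl i) / a j) =
      c * ∏ j ∈ D.erase i, thetaQuotient th q t (x i / x j) := by
    intro i hi
    have hs : (D.disjSum D).erase (Sum.inl i) = (D.erase i).disjSum D := by
      ext (k | k) <;> simp
    rw [hs, Finset.prod_disjSum, hmap]
    simp only [ha, Sum.elim_inl, Sum.elim_inr]
    have r1 : ∀ j, x i / (x j / t) = t * (x i / x j) := fun j => by
      rw [div_div_eq_mul_div, mul_comm, mul_div_assoc]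
    have r2 : ∀ j, x i / (t / q * x j) = q / t * (x i / x j) := fun j => by
      rw [div_mul_eq_div_div_swap, div_div_eq_mul_div, mul_comm _ q, ← mul_div_right_comm]
    have r3 : ∀ j, x i / (x j / q) = q * (x i / x j) := fun j => by
      rw [div_div_eq_mul_div, mul_comm, mul_div_assoc]
    simp only [r1, r2, r3]
    rw [← Finset.mul_prod_erase D (fun j => th (t * (x i / x j))) hi,
      ← Finset.mul_prod_erase D (fun j => th (q / t * (x i / x j))) hi,
      ← Finset.mul_prod_erase D (fun j => th (q * (x i / x j))) hi]
    simp only [thetaQuotient, Finset.prod_div_distrib, Finset.prod_mul_distrib, div_self', mul_one,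
      hc]
    rw [div_mul_div_comm]
    congr 1 <;> ring
  have e2 : ∀ i ∈ D, (B.map fun b => th (a (Sum.inr i) / b)).prod /
      ∏ j ∈ (D.disjSum D).erase (Sum.inr i), th (a (Sum.inr i) / a j) =
      -c * ∏ j ∈ D.erase i, thetaQuotient th q t (x j / x i) := by
    intro i hi
    have hs : (D.disjSum D).erase (Sum.inr i) = D.disjSum (D.erase i) := by
      ext (k | k) <;> simp
    rw [hs, Finset.prod_disjSum, hmap]
    simp only [ha, Sum.elim_inl, Sum.elim_inr]
    have r1 : ∀ j, x i / q / (x j / t) = (q / t * (x j / x i))⁻¹ := fun j => by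
      rw [mul_inv, inv_div, inv_div, div_div_div_eq, div_mul_div_comm, mul_comm (x i)]
    have r2 : ∀ j, x i / q / (t / q * x j) = (t * (x j / x i))⁻¹ := fun j => by
      rw [mul_inv, inv_div, div_mul_eq_mul_div, div_div_div_cancel_right, ← div_div,
        div_eq_mul_inv _ t, mul_div_right_comm, mul_comm]
    have r3 : ∀ j, x i / q / x j = (q * (x j / x i))⁻¹ := fun j => by
      rw [mul_inv, inv_div, div_right_comm, div_eq_mul_inv, mul_comm]
    have r4 : ∀ j, x i / q / (x j / q) = (x j / x i)⁻¹ := fun j => by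
      rw [inv_div, div_div_div_cancel_right]
    simp only [r1, r2, r3, r4, ← h.thetaQuotient_inv]
    rw [← Finset.mul_prod_erase D (fun j => th (q / t * (x j / x i))⁻¹) hi,
      ← Finset.mul_prod_erase D (fun j => th (t * (x j / x i))⁻¹) hi,
      ← Finset.mul_prod_erase D (fun j => th (q * (x j / x i))⁻¹) hi]
    have hcc : th (q / t)⁻¹ * th t⁻¹ / th q⁻¹ = -c := by
      have hχ : ((χ (q / t)⁻¹ : Kˣ) : K) * χ t⁻¹ = χ q⁻¹ := by
        rw [← Units.val_mul, ← map_mul, ← mul_inv, div_mul_cancel]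
      have hn := h.ne_zero hq
      have hu := (χ q⁻¹).ne_zero
      rw [h.map_inv, h.map_inv, h.map_inv, hc]
      field_simp
      linear_combination (-th t * th (q / t)) * hχ
    rw [← hcc]
    simp only [Finset.prod_div_distrib, Finset.prod_mul_distrib, div_self', mul_one]
    rw [div_mul_div_comm]
    congr 1 <;> ring
  rw [Finset.sum_congr rfl e1, Finset.sum_congr rfl e2, ← Finset.mul_sum, ← Finset.mul_sum,
    neg_mul, ← sub_eq_add_neg, ← mul_sub, mul_eq_zero] at key
  exact sub_eq_zero.1 (key.resolve_left hc0)

end PartialFraction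

end Ruijsenaars

/-! ### The Jacobi series as a theta function -/

namespace Ruijsenaars

section JacobiIsTheta

open PowerSeries

variable (F : Type*) [Field F]

/-- The theta function with values in the field of fractions. -/
noncomputable def jacFrac (u : Fˣ) : FractionRing F⟦X⟧ := algebraMap F⟦X⟧ _ (jac u)

/-- The constants in the field of fractions. -/
noncomputable def constFrac : Fˣ →* (FractionRing F⟦X⟧)ˣ :=
  Units.map (((algebraMap F⟦X⟧ (FractionRing F⟦X⟧)).comp C : F →+* _) : F →* _)

theorem isTheta_jacFrac [CharZero F] : IsTheta (constFrac F) (jacFrac F) where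
  eq_zero_iff u := by
    rw [jacFrac, map_eq_zero_iff _ (IsFractionRing.injective _ _), jac_eq_zero_iff]
  map_inv u := by
    rw [jacFrac, jac_inv, map_mul, map_neg]
    rfl
  exists_span B := by
    refine ⟨fun a => algebraMap F⟦X⟧ _ (laurentSum (fun k => 2 * tri k) (a * a / B)),
      fun a => algebraMap F⟦X⟧ _ (C (a : F) * laurentSum (fun k => k.natAbs ^ 2) (a * a / B)),
      fun b₁ b₂ hB => ⟨algebraMap F⟦X⟧ _ (laurentSum (fun c => c.natAbs ^ 2) (b₂ / b₁)),
      -algebraMap F⟦X⟧ _ (C ((b₁⁻¹ : Fˣ) : F) * laurentSum (fun c => 2 * tri (c + 1)) (b₂ / b₁)),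
      fun a => ?_⟩⟩
    rw [jacFrac, jacFrac, ← map_mul, jac_mul_jac, div_mul_div_comm, hB, div_div_div_cancel_left,
      div_eq_mul_inv a b₁, Units.val_mul]
    simp only [map_mul, map_sub]
    ring

end JacobiIsTheta

/-! ### Expansion in powers of the nome over a field containing all ratios of positions -/

section Slice

open MvPowerSeries

variable {n : ℕ}

/-- The field of fractions of the ring of formal power series. -/
abbrev Frac (n : ℕ) : Type := FractionRing (MvPowerSeries (Fin n) ℂ)

/-- The embedding of the ring of formal power series into its field of fractions. -/
noncomputable abbrev toFrac : MvPowerSeries (Fin n) ℂ →+* Frac n := algebraMap _ _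

instance instIsDomainMvPowerSeries : IsDomain (MvPowerSeries (Fin n) ℂ) :=
  NoZeroDivisors.to_isDomain _

theorem X_ne_zero (k : Fin n) : (X k : MvPowerSeries (Fin n) ℂ) ≠ 0 := by
  classical
  intro h
  have := congrArg (coeff (Finsupp.single k 1)) h
  simp [coeff_index_single_self_X] at this

theorem ratio_ne_zero (i j : Fin n) : ratio i j ≠ 0 :=
  Finset.prod_ne_zero_iff.2 fun k _ => X_ne_zero k

theorem nome_ne_zero : nome n ≠ 0 :=
  Finset.prod_ne_zero_iff.2 fun k _ => X_ne_zero k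

/-- The exponent `(k, …, k)`. -/
noncomputable def diag (n k : ℕ) : Fin n →₀ ℕ := Finsupp.equivFunOnFinite.symm fun _ => k

theorem diag_apply (k : ℕ) (i : Fin n) : diag n k i = k := rfl

theorem nome_pow_eq_monomial (k : ℕ) : nome n ^ k = monomial (diag n k) (1 : ℂ) := by
  classical
  have h : ∀ s : Finset (Fin n), (∏ i ∈ s, (X i : MvPowerSeries (Fin n) ℂ)) ^ k =
      monomial (∑ i ∈ s, Finsupp.single i k) 1 := by
    intro s
    induction s using Finset.induction_on with
    | empty => simp [monomial_zero_one]
    | insert i s hi ih =>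
      rw [Finset.prod_insert hi, Finset.sum_insert hi, mul_pow, ih, X_pow_eq,
        monomial_mul_monomial, one_mul]
  have hd : ∑ i : Fin n, Finsupp.single i k = diag n k := by
    ext i
    simp [diag_apply, Finsupp.finsetSum_apply, Finsupp.single_apply]
  rw [nome, h, hd]

theorem coeff_nome_pow [DecidableEq (Fin n →₀ ℕ)] (k : ℕ) (d : Fin n →₀ ℕ) :
    coeff d (nome n ^ k) = if d = diag n k then 1 else 0 := by
  rw [nome_pow_eq_monomial, coeff_monomial]
  split_ifs <;> rfl

variable [NeZero n]

/-- The part of a power series that is homogeneous of degree `k` in the variable `z_0`. -/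
noncomputable def part (k : ℕ) (f : MvPowerSeries (Fin n) ℂ) : MvPowerSeries (Fin n) ℂ :=
  fun d => if d 0 = k then coeff d f else 0

theorem coeff_part (k : ℕ) (f : MvPowerSeries (Fin n) ℂ) (d : Fin n →₀ ℕ) :
    coeff d (part k f) = if d 0 = k then coeff d f else 0 := rfl

theorem part_mul (k : ℕ) (f g : MvPowerSeries (Fin n) ℂ) :
    part k (f * g) = ∑ ij ∈ Finset.HasAntidiagonal.antidiagonal k, part ij.1 f * part ij.2 g := by
  classical
  ext d
  rw [coeff_part, map_sum]
  simp only [coeff_mul, coeff_part]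
  rw [Finset.sum_comm]
  have key : ∀ ab ∈ Finset.HasAntidiagonal.antidiagonal d,
      ∑ ij ∈ Finset.HasAntidiagonal.antidiagonal k,
        ((if ab.1 0 = ij.1 then coeff ab.1 f else 0) *
          if ab.2 0 = ij.2 then coeff ab.2 g else 0) =
      if d 0 = k then coeff ab.1 f * coeff ab.2 g else 0 := by
    intro ab hab
    have hd : d 0 = ab.1 0 + ab.2 0 := by
      rw [← Finset.HasAntidiagonal.mem_antidiagonal.1 hab, Finsupp.add_apply]
    split_ifs with h
    · rw [Finset.sum_eq_single (ab.1 0, ab.2 0)]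
      · simp
      · rintro ⟨i, j⟩ _ hne
        by_cases h1 : ab.1 0 = i
        · by_cases h2 : ab.2 0 = j
          · exact absurd (by rw [h1, h2]) hne
          · simp [h2]
        · simp [h1]
      · intro hn
        exact absurd (Finset.HasAntidiagonal.mem_antidiagonal.2 (hd.symm.trans h)) hn
    · refine Finset.sum_eq_zero fun ij hij => ?_
      have hij := Finset.HasAntidiagonal.mem_antidiagonal.1 hij
      by_cases h1 : ab.1 0 = ij.1
      · have h2 : ab.2 0 ≠ ij.2 := by omega
        simp [h2]
      · simp [h1]
  rw [Finset.sum_congr rfl key]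
  split_ifs <;> simp

theorem part_add (k : ℕ) (f g : MvPowerSeries (Fin n) ℂ) :
    part k (f + g) = part k f + part k g := by
  ext d
  rw [map_add, coeff_part, coeff_part, coeff_part, map_add]
  split_ifs <;> simp

theorem part_eq_zero {k : ℕ} {f : MvPowerSeries (Fin n) ℂ} (h : ∀ d, d 0 = k → coeff d f = 0) :
    part k f = 0 := by
  ext d
  rw [coeff_part]
  split_ifs with h0
  · rw [h d h0, map_zero (coeff d)]
  · rw [map_zero (coeff d)]

theorem part_eq_self {k : ℕ} {f : MvPowerSeries (Fin n) ℂ} (h : ∀ d, d 0 ≠ k → coeff d f = 0) :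
    part k f = f := by
  ext d
  rw [coeff_part]
  split_ifs with h0
  · rfl
  · exact (h d h0).symm

/-- The expansion of a power series in powers of the nome, the ratios `x_j / x_i` being
treated as constants. -/
noncomputable def slice : MvPowerSeries (Fin n) ℂ →+* PowerSeries (Frac n) where
  -- Eliminating `z_0` by `z_0 = p / (z_1 ⋯ z_{n-1})`: the part of degree `k` in `z_0` carries
  -- exactly `p ^ k`, and the quotient by `nome n ^ k` is free of `z_0`.
  toFun f := PowerSeries.mk fun k => toFrac (part k f) /
    toFrac (nome n) ^ k
  map_one' := by
    classical
    ext k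
    rw [PowerSeries.coeff_mk, PowerSeries.coeff_one]
    split_ifs with hk
    · rw [hk, part_eq_self, map_one, pow_zero, div_one]
      intro d hd
      rw [coeff_one, if_neg]
      rintro rfl
      exact hd rfl
    · rw [part_eq_zero, map_zero, zero_div]
      intro d hd
      rw [coeff_one, if_neg]
      rintro rfl
      exact hk hd.symm
  map_mul' f g := by
    ext k
    rw [PowerSeries.coeff_mul, PowerSeries.coeff_mk, part_mul, map_sum, Finset.sum_div]
    refine Finset.sum_congr rfl fun ij hij => ?_
    rw [PowerSeries.coeff_mk, PowerSeries.coeff_mk, map_mul, div_mul_div_comm, ← pow_add,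
      Finset.HasAntidiagonal.mem_antidiagonal.1 hij]
  map_zero' := by
    ext k
    rw [PowerSeries.coeff_mk, part_eq_zero (fun _ _ => map_zero _), map_zero, zero_div, map_zero]
  map_add' f g := by
    ext k
    rw [map_add, PowerSeries.coeff_mk, PowerSeries.coeff_mk, PowerSeries.coeff_mk, part_add,
      map_add, add_div]

theorem coeff_slice (k : ℕ) (f : MvPowerSeries (Fin n) ℂ) :
    PowerSeries.coeff k (slice f) = toFrac (part k f) /
      toFrac (nome n) ^ k :=
  PowerSeries.coeff_mk k fun k => toFrac (part k f) / toFrac (nome n) ^ k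

theorem slice_injective : Function.Injective (slice (n := n)) := by
  rw [injective_iff_map_eq_zero]
  intro f hf
  ext d
  have h := congrArg (PowerSeries.coeff (d 0)) hf
  rw [coeff_slice, map_zero (PowerSeries.coeff _), div_eq_zero_iff, map_eq_zero_iff _ (IsFractionRing.injective _ _)] at h
  rcases h with h | h
  · have := congrArg (coeff d) h
    simpa [coeff_part] using this
  · exact absurd h (pow_ne_zero _ ((map_ne_zero_iff _ (IsFractionRing.injective _ _)).2
      nome_ne_zero))

theorem X_pow_dvd_slice {N : ℕ} {f : MvPowerSeries (Fin n) ℂ} (h : X 0 ^ N ∣ f) :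
    PowerSeries.X ^ N ∣ slice f := by
  rw [PowerSeries.X_pow_dvd_iff]
  intro k hk
  rw [X_pow_dvd_iff] at h
  rw [coeff_slice, part_eq_zero fun d hd => h d (by omega), map_zero, zero_div]

theorem slice_of_part_zero {f : MvPowerSeries (Fin n) ℂ} (h : ∀ d, d 0 ≠ 0 → coeff d f = 0) :
    slice f = PowerSeries.C (toFrac f) := by
  ext k
  rw [coeff_slice, PowerSeries.coeff_C]
  split_ifs with hk
  · rw [hk, pow_zero, div_one, part_eq_self h]
  · rw [part_eq_zero fun d hd => h d (by omega), map_zero, zero_div]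

theorem slice_C (c : ℂ) :
    slice (C c : MvPowerSeries (Fin n) ℂ) = PowerSeries.C (toFrac (C c)) := by
  classical
  refine slice_of_part_zero fun d hd => ?_
  rw [coeff_C, if_neg]
  rintro rfl
  exact hd rfl

theorem slice_X {k : Fin n} (hk : k ≠ 0) :
    slice (X k : MvPowerSeries (Fin n) ℂ) = PowerSeries.C (toFrac (X k)) := by
  classical
  refine slice_of_part_zero fun d hd => ?_
  rw [coeff_X, if_neg]
  rintro rfl
  exact hd (by simp [hk])

theorem slice_ratio (i j : Fin n) :
    slice (ratio i j) = PowerSeries.C (toFrac (ratio i j)) := by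
  rw [ratio, map_prod, map_prod, map_prod]
  refine Finset.prod_congr rfl fun k hk => slice_X ?_
  rintro rfl
  exact absurd (Finset.mem_Ioc.1 hk).1 (by simp)

theorem slice_nome : slice (nome n) = PowerSeries.X := by
  classical
  have h : ∀ d, d 0 ≠ 1 → coeff d (nome n) = 0 := fun d hd => by
    rw [← pow_one (nome n), coeff_nome_pow, if_neg]
    rintro rfl
    exact hd rfl
  ext k
  rw [coeff_slice, PowerSeries.coeff_X]
  split_ifs with hk
  · rw [hk, pow_one, part_eq_self h]
    exact div_self ((map_ne_zero_iff _ (IsFractionRing.injective _ _)).2 nome_ne_zero)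
  · rw [part_eq_zero fun d hd => h d (by omega), map_zero, zero_div]

theorem slice_nomeRatio (i j : Fin n) :
    slice (nomeRatio i j) =
      PowerSeries.X * PowerSeries.C (toFrac (ratio i j))⁻¹ := by
  have h := congrArg slice (ratio_mul_nomeRatio i j)
  have hr : toFrac (ratio i j) ≠ 0 :=
    (map_ne_zero_iff _ (IsFractionRing.injective _ _)).2 (ratio_ne_zero i j)
  rw [map_mul, slice_ratio, slice_nome] at h
  rw [← h, mul_right_comm, ← map_mul, mul_inv_cancel₀ hr, map_one, one_mul]

end Slice

end Ruijsenaars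

/-! ### Product form of theta against the Jacobi series -/

namespace Ruijsenaars

open MvPowerSeries

theorem ratio_mul_ratio {n : ℕ} {i j k : Fin n} (hij : i ≤ j) (hjk : j ≤ k) :
    ratio i j * ratio j k = ratio i k := by
  rw [ratio, ratio, ratio, ← Finset.prod_union]
  · rw [Finset.Ioc_union_Ioc_eq_Ioc hij hjk]
  · exact Finset.Ioc_disjoint_Ioc_of_le le_rfl

section ThetaSlice

variable {n : ℕ} [NeZero n]

theorem X_zero_dvd_nome : (X 0 : MvPowerSeries (Fin n) ℂ) ∣ nome n :=
  Finset.dvd_prod_of_mem _ (Finset.mem_univ 0)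

open scoped MvPowerSeries.WithPiTopology in
theorem pochhammerInf_eq_mul (a : MvPowerSeries (Fin n) ℂ) :
    pochhammerInf a = (1 - a) * pochhammerInf (nome n * a) := by
  have h : ∀ k : ℕ, (1 - nome n ^ (k + 1) * a) = 1 - nome n ^ k * (nome n * a) := fun k => by
    rw [pow_succ, mul_assoc]
  have hm : Multipliable fun k : ℕ => (1 - nome n ^ (k + 1) * a) :=
    (multipliable_pochhammerInf (nome n * a)).congr fun k => (h k).symm
  have key : ∏' k : ℕ, (1 - nome n ^ k * a) =
      (1 - nome n ^ 0 * a) * ∏' k : ℕ, (1 - nome n ^ (k + 1) * a) := tprod_eq_zero_mul' hm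
  unfold pochhammerInf
  rw [key, pow_zero, one_mul, tprod_congr h]

theorem pochhammerInf_eq_prod_mul (a : MvPowerSeries (Fin n) ℂ) (N : ℕ) :
    pochhammerInf a =
      (∏ k ∈ Finset.range N, (1 - nome n ^ k * a)) * pochhammerInf (nome n ^ N * a) := by
  induction N with
  | zero => simp
  | succ N ih =>
    rw [ih, Finset.prod_range_succ, pochhammerInf_eq_mul (nome n ^ N * a), mul_assoc, pow_succ',
      mul_assoc (nome n)]

open scoped MvPowerSeries.WithPiTopology in
theorem X_zero_pow_dvd_pochhammerInf_sub_one (a : MvPowerSeries (Fin n) ℂ) (N : ℕ) :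
    X 0 ^ N ∣ pochhammerInf (nome n ^ N * a) - 1 := by
  have hfin : ∀ s : Finset ℕ,
      X 0 ^ N ∣ ∏ k ∈ s, (1 - nome n ^ k * (nome n ^ N * a)) - 1 := by
    intro s
    induction s using Finset.induction_on with
    | empty => simp
    | insert k s hk ih =>
      rw [Finset.prod_insert hk]
      have h1 : (X 0 : MvPowerSeries (Fin n) ℂ) ^ N ∣ nome n ^ k * (nome n ^ N * a) :=
        ((pow_dvd_pow_of_dvd X_zero_dvd_nome N).mul_right a).mul_left _
      convert dvd_sub ih (h1.mul_right (∏ k ∈ s, (1 - nome n ^ k * (nome n ^ N * a)))) using 1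
      ring
  rw [X_pow_dvd_iff]
  intro d hd
  rw [map_sub, sub_eq_zero]
  have ht := ((WithPiTopology.continuous_coeff ℂ d).tendsto _).comp
    (multipliable_pochhammerInf (nome n ^ N * a)).hasProd
  refine tendsto_nhds_unique ht (tendsto_const_nhds.congr fun s => ?_)
  have := X_pow_dvd_iff.1 (hfin s) d hd
  rw [map_sub, sub_eq_zero] at this
  exact this.symm

theorem X_pow_dvd_slice_pochhammerInf (a : MvPowerSeries (Fin n) ℂ) (N : ℕ) :
    PowerSeries.X ^ N ∣ slice (pochhammerInf a) -
      ∏ k ∈ Finset.range N, (1 - PowerSeries.X ^ k * slice a) := by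
  have h := X_pow_dvd_slice (X_zero_pow_dvd_pochhammerInf_sub_one a N)
  have h1 : slice (∏ k ∈ Finset.range N, (1 - nome n ^ k * a)) =
      ∏ k ∈ Finset.range N, (1 - PowerSeries.X ^ k * slice a) := by
    rw [map_prod]
    refine Finset.prod_congr rfl fun k _ => ?_
    rw [map_sub, map_one, map_mul, map_pow, slice_nome]
  rw [pochhammerInf_eq_prod_mul a N, map_mul, ← h1]
  rw [map_sub, map_one] at h
  convert h.mul_left (slice (∏ k ∈ Finset.range N, (1 - nome n ^ k * a))) using 1
  ring

/-- The nonzero constants. -/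
noncomputable def constUnit : ℂˣ →* (Frac n)ˣ :=
  Units.map ((toFrac.comp C : ℂ →+* Frac n) : ℂ →* Frac n)

/-- The position variable `x_i`, normalized by `x_0 = 1`. -/
noncomputable def position (i : Fin n) : (Frac n)ˣ :=
  Units.mk0 (toFrac (ratio 0 i))
    ((map_ne_zero_iff _ (IsFractionRing.injective _ _)).2 (ratio_ne_zero 0 i))

theorem val_constUnit_mul_position_div {i j : Fin n} (hij : i ≤ j) (c : ℂˣ) :
    ((constUnit c * (position j / position i) : (Frac n)ˣ) : Frac n) =
      toFrac (C (c : ℂ) * ratio i j) := by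
  have h : position j / position i = Units.mk0 (toFrac (ratio i j))
      ((map_ne_zero_iff _ (IsFractionRing.injective _ _)).2 (ratio_ne_zero i j)) := by
    rw [div_eq_iff_eq_mul]
    ext
    rw [Units.val_mul, Units.val_mk0, position, position, Units.val_mk0, Units.val_mk0, ← map_mul,
      mul_comm, ratio_mul_ratio (Fin.zero_le i) hij]
  rw [h, Units.val_mul, map_mul]
  rfl

/-- The constant that relates product and series form of the theta function. -/
noncomputable def thetaConst (n : ℕ) [NeZero n] : PowerSeries (Frac n) :=
  slice (pochhammerInf (nome n))

/-- The triple product identity, obtained by comparing truncated products modulo each power of the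
nome. It transfers the partial fraction identities to `theta`; the factor `(p; p)_∞` is the same for
all arguments and cancels in quotients. -/
theorem thetaConst_mul_slice_theta {i j : Fin n} (hij : i ≤ j) (c : ℂˣ) :
    thetaConst n * slice (theta (c : ℂ) i j) =
      jac (constUnit c * (position j / position i)) := by
  set u := constUnit c * (position j / position i) with hu
  have hval := val_constUnit_mul_position_div hij c
  refine eq_of_forall_X_pow_dvd_sub fun N => ?_
  have h0 := X_pow_dvd_slice_pochhammerInf (nome n) N
  have h1 := X_pow_dvd_slice_pochhammerInf (C (c : ℂ) * ratio i j) N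
  have h2 := X_pow_dvd_slice_pochhammerInf (C ((c : ℂ)⁻¹) * nomeRatio i j) N
  have h3 := X_pow_dvd_eulerProd_mul_thetaProd_sub_jac u N
  have e0 : ∏ k ∈ Finset.range N, (1 - PowerSeries.X ^ k * slice (nome n)) =
      eulerProd (PowerSeries.X : PowerSeries (Frac n)) N := by
    rw [slice_nome, eulerProd]
    simp only [pow_succ]
  have e1 : slice (C (c : ℂ) * ratio i j) = PowerSeries.C ((u : (Frac n)ˣ) : Frac n) := by
    rw [map_mul, slice_C, slice_ratio, ← map_mul, ← map_mul, ← hval]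
  have e2 : slice (C ((c : ℂ)⁻¹) * nomeRatio i j) =
      PowerSeries.X * PowerSeries.C ((u⁻¹ : (Frac n)ˣ) : Frac n) := by
    have hc : toFrac (C ((c : ℂ)⁻¹)) = (toFrac (C (c : ℂ)) : Frac n)⁻¹ :=
      map_inv₀ (toFrac.comp C : ℂ →+* Frac n) (c : ℂ)
    rw [map_mul, slice_C, slice_nomeRatio, mul_left_comm, Units.val_inv_eq_inv_val,
      hval, map_mul toFrac, mul_inv, hc, map_mul]
  rw [e0] at h0
  rw [e1] at h1
  rw [e2] at h2
  rw [thetaProd] at h3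
  rw [theta, map_mul, thetaConst]
  generalize slice (pochhammerInf (nome n)) = a0 at *
  generalize slice (pochhammerInf (C (c : ℂ) * ratio i j)) = a1 at *
  generalize slice (pochhammerInf (C ((c : ℂ)⁻¹) * nomeRatio i j)) = a2 at *
  generalize eulerProd (PowerSeries.X : PowerSeries (Frac n)) N = b0 at *
  generalize ∏ k ∈ Finset.range N, (1 - PowerSeries.X ^ k * PowerSeries.C (u : Frac n)) = b1 at *
  generalize ∏ k ∈ Finset.range N, (1 - PowerSeries.X ^ k *
    (PowerSeries.X * PowerSeries.C ((u⁻¹ : (Frac n)ˣ) : Frac n))) = b2 at *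
  -- Telescoping of `a0 * a1 * a2 - b0 * b1 * b2`, one factor at a time.
  convert dvd_add (dvd_add (dvd_add (h0.mul_right (a1 * a2)) (h1.mul_right (b0 * a2)))
    (h2.mul_right (b0 * b1))) h3 using 1
  ring

theorem thetaConst_ne_zero : thetaConst n ≠ 0 := by
  intro h
  have h0 := X_pow_dvd_slice_pochhammerInf (nome n) 1
  rw [← thetaConst, h, Finset.prod_range_one, pow_zero, one_mul, slice_nome, pow_one,
    PowerSeries.X_dvd_iff] at h0
  simp at h0

end ThetaSlice

end Ruijsenaars

/-! ### The shift as a ring homomorphism and its action on theta functions -/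

namespace Ruijsenaars

open MvPowerSeries

section Shift

variable {n : ℕ} {q : ℂ}

/-- The factor by which the `q`-shift of the variables in `I` multiplies `x_i`. -/
noncomputable def posFactor (q : ℂ) (I : Finset (Fin n)) (i : Fin n) : ℂ := if i ∈ I then q else 1

theorem posFactor_ne_zero (hq : q ≠ 0) (I : Finset (Fin n)) (i : Fin n) :
    posFactor q I i ≠ 0 := by
  rw [posFactor]
  split_ifs
  · exact hq
  · exact one_ne_zero

theorem constantCoeff_ratio {i j : Fin n} (hij : i < j) : constantCoeff (ratio i j) = 0 := by
  rw [ratio, map_prod]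
  exact Finset.prod_eq_zero (Finset.mem_Ioc.2 ⟨hij, le_rfl⟩) (constantCoeff_X j)

theorem map_inv_of_constantCoeff {S : Type*} [Field S] (g : MvPowerSeries (Fin n) ℂ →+* S)
    {f : MvPowerSeries (Fin n) ℂ} (hf : constantCoeff f ≠ 0) : g f⁻¹ = (g f)⁻¹ := by
  refine eq_inv_of_mul_eq_one_left ?_
  rw [← map_mul, MvPowerSeries.inv_mul_cancel f hf, map_one]

variable [NeZero n]

/-- The factor by which the `q`-shift of the variables in `I` multiplies the monomial `z ^ d`. -/
noncomputable def shiftFactor (q : ℂ) (I : Finset (Fin n)) (d : Fin n →₀ ℕ) : ℂ :=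
  ∏ i ∈ I, q ^ xExponent d i

theorem coeff_qShift (q : ℂ) (I : Finset (Fin n)) (f : MvPowerSeries (Fin n) ℂ) (d : Fin n →₀ ℕ) :
    coeff d (qShift q I f) = shiftFactor q I d * coeff d f := rfl

theorem shiftFactor_add (hq : q ≠ 0) (I : Finset (Fin n)) (d e : Fin n →₀ ℕ) :
    shiftFactor q I (d + e) = shiftFactor q I d * shiftFactor q I e := by
  rw [shiftFactor, shiftFactor, shiftFactor, ← Finset.prod_mul_distrib]
  refine Finset.prod_congr rfl fun i _ => ?_
  rw [← zpow_add₀ hq]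
  congr 1
  simp only [xExponent, Finsupp.add_apply]
  push_cast
  ring

theorem xExponent_diag (k : ℕ) (i : Fin n) : xExponent (diag n k) i = 0 := by
  simp [xExponent, diag_apply]

theorem shiftFactor_diag (q : ℂ) (I : Finset (Fin n)) (k : ℕ) :
    shiftFactor q I (diag n k) = 1 := by
  simp [shiftFactor, xExponent_diag]

theorem shiftFactor_zero (q : ℂ) (I : Finset (Fin n)) : shiftFactor q I 0 = 1 := by
  simp [shiftFactor, xExponent]

/-- The `q`-shift operator as a ring homomorphism. -/
noncomputable def shiftHom (hq : q ≠ 0) (I : Finset (Fin n)) :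
    MvPowerSeries (Fin n) ℂ →+* MvPowerSeries (Fin n) ℂ where
  toFun := qShift q I
  map_one' := by
    classical
    ext d
    rw [coeff_qShift, coeff_one]
    split_ifs with h
    · rw [h, shiftFactor_zero, mul_one]
    · rw [mul_zero]
  map_mul' f g := by
    classical
    ext d
    rw [coeff_qShift, coeff_mul, coeff_mul, Finset.mul_sum]
    refine Finset.sum_congr rfl fun ab hab => ?_
    rw [coeff_qShift, coeff_qShift, ← Finset.HasAntidiagonal.mem_antidiagonal.1 hab,
      shiftFactor_add hq]
    ring
  map_zero' := by
    ext d
    rw [coeff_qShift, map_zero (coeff d), mul_zero]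
  map_add' f g := by
    ext d
    rw [coeff_qShift, map_add (coeff d), map_add (coeff d), coeff_qShift, coeff_qShift, mul_add]

theorem shiftHom_apply (hq : q ≠ 0) (I : Finset (Fin n)) (f : MvPowerSeries (Fin n) ℂ) :
    shiftHom hq I f = qShift q I f := rfl

theorem qShift_monomial (q : ℂ) (I : Finset (Fin n)) (d : Fin n →₀ ℕ) (c : ℂ) :
    qShift q I (monomial d c) = C (shiftFactor q I d) * monomial d c := by
  classical
  ext e
  rw [coeff_qShift, coeff_C_mul, coeff_monomial]
  split_ifs with h
  · rw [h]
  · rw [mul_zero, mul_zero]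

theorem shiftHom_C (hq : q ≠ 0) (I : Finset (Fin n)) (c : ℂ) :
    shiftHom hq I (C c) = C c := by
  rw [shiftHom_apply, ← monomial_zero_eq_C_apply, qShift_monomial, shiftFactor_zero, map_one,
    one_mul]

theorem shiftHom_nome (hq : q ≠ 0) (I : Finset (Fin n)) : shiftHom hq I (nome n) = nome n := by
  rw [shiftHom_apply, ← pow_one (nome n), nome_pow_eq_monomial, qShift_monomial, shiftFactor_diag,
    map_one, one_mul]

theorem shiftHom_ratio (hq : q ≠ 0) (I : Finset (Fin n)) {i j : Fin n} (hij : i < j) :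
    shiftHom hq I (ratio i j) = C (posFactor q I j / posFactor q I i) * ratio i j := by
  classical
  set d : Fin n →₀ ℕ := ∑ k ∈ Finset.Ioc i j, Finsupp.single k 1 with hd
  have h1 : ∀ s : Finset (Fin n), ∏ k ∈ s, (X k : MvPowerSeries (Fin n) ℂ) =
      monomial (∑ k ∈ s, Finsupp.single k 1) 1 := by
    intro s
    induction s using Finset.induction_on with
    | empty => simp [monomial_zero_one]
    | insert i s hi ih =>
      rw [Finset.prod_insert hi, Finset.sum_insert hi, ih, X, monomial_mul_monomial, one_mul]
  have hval : ∀ l, d l = if l ∈ Finset.Ioc i j then 1 else 0 := by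
    intro l
    rw [hd, Finsupp.finsetSum_apply]
    simp only [Finsupp.single_apply, Finset.sum_ite_eq']
  have hexp : ∀ l, xExponent d l = (if l = j then 1 else 0) - if l = i then 1 else 0 := by
    intro l
    rw [xExponent, hval, hval]
    simp only [Finset.mem_Ioc]
    -- The successor in `Fin n` is cyclic; the last index is followed by `0`, which never lies in
    -- `Finset.Ioc i j`.
    have hlast : ((l + 1 : Fin n) : ℕ) = if (l : ℕ) + 1 = n then 0 else (l : ℕ) + 1 := by
      rw [Fin.val_add, Fin.val_one', Nat.add_mod_mod]
      split_ifs with h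
      · rw [h, Nat.mod_self]
      · exact Nat.mod_eq_of_lt (by omega)
    simp only [Fin.lt_def, Fin.le_def, Fin.ext_iff, hlast] at hij ⊢
    have := l.2
    have := j.2
    split_ifs <;> omega
  have hfac : shiftFactor q I d = posFactor q I j / posFactor q I i := by
    rw [shiftFactor]
    simp only [hexp, zpow_sub₀ hq, Finset.prod_div_distrib]
    congr 1
    · rw [posFactor]
      split_ifs with h
      · rw [Finset.prod_eq_single j] <;> simp +contextual [h]
      · exact Finset.prod_eq_one fun l hl => by
          rw [if_neg fun h0 : l = j => h (h0 ▸ hl), zpow_zero]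
    · rw [posFactor]
      split_ifs with h
      · rw [Finset.prod_eq_single i] <;> simp +contextual [h]
      · exact Finset.prod_eq_one fun l hl => by
          rw [if_neg fun h0 : l = i => h (h0 ▸ hl), zpow_zero]
  rw [ratio, h1, shiftHom_apply, qShift_monomial, ← hd, hfac]

theorem shiftHom_nomeRatio (hq : q ≠ 0) (I : Finset (Fin n)) {i j : Fin n} (hij : i < j) :
    shiftHom hq I (nomeRatio i j) =
      C (posFactor q I j / posFactor q I i)⁻¹ * nomeRatio i j := by
  set r := posFactor q I j / posFactor q I i with hr
  have hr0 : r ≠ 0 := div_ne_zero (posFactor_ne_zero hq I j) (posFactor_ne_zero hq I i)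
  have h := congrArg (shiftHom hq I) (ratio_mul_nomeRatio i j)
  rw [map_mul, shiftHom_nome, shiftHom_ratio hq I hij, ← hr, ← ratio_mul_nomeRatio i j,
    mul_comm (C r), mul_assoc] at h
  have h' := mul_left_cancel₀ (ratio_ne_zero i j) h
  conv_rhs => rw [← h', ← mul_assoc, ← map_mul, inv_mul_cancel₀ hr0, map_one, one_mul]

open scoped MvPowerSeries.WithPiTopology in
theorem shiftHom_pochhammerInf (hq : q ≠ 0) (I : Finset (Fin n)) (a : MvPowerSeries (Fin n) ℂ) :
    shiftHom hq I (pochhammerInf a) = pochhammerInf (shiftHom hq I a) := by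
  have hc : Continuous (shiftHom hq I) :=
    continuous_pi fun d => continuous_const.mul (WithPiTopology.continuous_coeff ℂ d)
  unfold pochhammerInf
  rw [(multipliable_pochhammerInf a).map_tprod (shiftHom hq I) hc]
  refine tprod_congr fun k => ?_
  rw [map_sub, map_one, map_mul, map_pow, shiftHom_nome]

theorem shiftHom_theta (hq : q ≠ 0) (I : Finset (Fin n)) {i j : Fin n} (hij : i < j) (c : ℂ) :
    shiftHom hq I (theta c i j) = theta (c * (posFactor q I j / posFactor q I i)) i j := by
  rw [theta, map_mul, shiftHom_pochhammerInf, shiftHom_pochhammerInf, map_mul, map_mul, shiftHom_C,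
    shiftHom_C, shiftHom_ratio hq I hij, shiftHom_nomeRatio hq I hij, theta, mul_inv, map_mul C,
    map_mul C, mul_assoc, mul_assoc]

theorem constantCoeff_pochhammerInf {a : MvPowerSeries (Fin n) ℂ} (ha : constantCoeff a = 0) :
    constantCoeff (pochhammerInf a) = 1 := by
  have h := X_zero_pow_dvd_pochhammerInf_sub_one a 1
  rw [pow_one, pow_one, X_dvd_iff] at h
  have h0 := h 0 rfl
  rw [coeff_zero_eq_constantCoeff_apply, map_sub, map_one, sub_eq_zero] at h0
  rw [pochhammerInf_eq_mul, map_mul, h0, map_sub, ha]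
  simp

theorem constantCoeff_nomeRatio (i j : Fin n) : constantCoeff (nomeRatio i j) = 0 := by
  rw [nomeRatio, map_prod]
  exact Finset.prod_eq_zero (i := 0) (by simp) (constantCoeff_X 0)

theorem constantCoeff_theta {i j : Fin n} (hij : i < j) (c : ℂ) :
    constantCoeff (theta c i j) = 1 := by
  rw [theta, map_mul, constantCoeff_pochhammerInf, constantCoeff_pochhammerInf, one_mul]
  · rw [map_mul, constantCoeff_nomeRatio, mul_zero]
  · rw [map_mul, constantCoeff_ratio hij, mul_zero]

end Shift

end Ruijsenaars

/-! ### The coefficients as products over pairs, and their shifts -/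

namespace Ruijsenaars

open MvPowerSeries

section Phi

variable {n : ℕ}

/-- The factor `θ (t c x_i / x_j; p) / θ (c x_i / x_j; p)` of the coefficients (up to a constant
if `i < j`). -/
noncomputable def phi (t c : ℂ) (i j : Fin n) : MvPowerSeries (Fin n) ℂ :=
  if i < j then theta (t⁻¹ * c⁻¹) i j * (theta c⁻¹ i j)⁻¹ else theta (t * c) j i * (theta c j i)⁻¹

theorem coeffB_eq_prod_phi (t : ℂ) (I : Finset (Fin n)) :
    coeffB t I = ∏ i ∈ I, ∏ j ∈ Iᶜ, phi t 1 i j := by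
  have h1 : ∏ ij : Fin n × Fin n with ij.1 < ij.2 ∧ ij.1 ∈ I ∧ ij.2 ∉ I,
      theta t⁻¹ ij.1 ij.2 * (theta 1 ij.1 ij.2)⁻¹ =
      ∏ ij ∈ (I ×ˢ Iᶜ) with ij.1 < ij.2, phi t 1 ij.1 ij.2 := by
    refine Finset.prod_congr ?_ fun ij hij => ?_
    · ext ij
      simp only [Finset.mem_filter, Finset.mem_univ, true_and, Finset.mem_product,
        Finset.mem_compl]
      tauto
    · rw [phi, if_pos (Finset.mem_filter.1 hij).2, inv_one, mul_one]
  have h2 : ∏ ij : Fin n × Fin n with ij.1 < ij.2 ∧ ij.1 ∉ I ∧ ij.2 ∈ I,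
      theta t ij.1 ij.2 * (theta 1 ij.1 ij.2)⁻¹ =
      ∏ ij ∈ (I ×ˢ Iᶜ) with ¬ ij.1 < ij.2, phi t 1 ij.1 ij.2 := by
    refine Finset.prod_bij' (fun ij _ => ij.swap) (fun ij _ => ij.swap) ?_ ?_ ?_ ?_ ?_
    · rintro ⟨i, j⟩ hij
      simp only [Finset.mem_filter, Finset.mem_univ, true_and, Finset.mem_product,
        Finset.mem_compl, Prod.swap, not_lt] at hij ⊢
      exact ⟨⟨hij.2.2, hij.2.1⟩, hij.1.le⟩
    · rintro ⟨i, j⟩ hij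
      simp only [Finset.mem_filter, Finset.mem_univ, true_and, Finset.mem_product,
        Finset.mem_compl, Prod.swap, not_lt] at hij ⊢
      exact ⟨hij.2.lt_of_ne fun h0 => hij.1.2 (h0 ▸ hij.1.1), hij.1.2, hij.1.1⟩
    · simp
    · simp
    · rintro ⟨i, j⟩ hij
      simp only [Finset.mem_filter, Finset.mem_univ, true_and] at hij
      simp only [Prod.swap]
      rw [phi, if_neg hij.1.not_gt, mul_one]
  rw [coeffB, h1, h2, Finset.prod_filter_mul_prod_filter_not, Finset.prod_product]

variable [NeZero n] {q : ℂ}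

theorem constantCoeff_phi (t c : ℂ) {i j : Fin n} (hij : i ≠ j) :
    constantCoeff (phi t c i j) = 1 := by
  rw [phi]
  split_ifs with h
  · rw [map_mul, constantCoeff_inv, constantCoeff_theta h, constantCoeff_theta h, inv_one, one_mul]
  · have h := lt_of_le_of_ne (not_lt.1 h) hij.symm
    rw [map_mul, constantCoeff_inv, constantCoeff_theta h, constantCoeff_theta h, inv_one, one_mul]

theorem constantCoeff_coeffB (t : ℂ) (I : Finset (Fin n)) : constantCoeff (coeffB t I) = 1 := by
  rw [coeffB_eq_prod_phi, map_prod]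
  refine Finset.prod_eq_one fun i hi => ?_
  rw [map_prod]
  refine Finset.prod_eq_one fun j hj => constantCoeff_phi t 1 ?_
  rintro rfl
  exact Finset.mem_compl.1 hj hi

theorem shiftHom_inv_theta (hq : q ≠ 0) (I : Finset (Fin n)) {i j : Fin n} (hij : i < j) (c : ℂ) :
    shiftHom hq I (theta c i j)⁻¹ =
      (theta (c * (posFactor q I j / posFactor q I i)) i j)⁻¹ := by
  have h : ∀ c, constantCoeff (theta c i j) ≠ 0 := fun c => by
    rw [constantCoeff_theta hij]
    exact one_ne_zero
  rw [MvPowerSeries.eq_inv_iff_mul_eq_one (h _), ← shiftHom_theta hq I hij, ← map_mul,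
    MvPowerSeries.inv_mul_cancel _ (h c), map_one]

theorem shiftHom_phi (hq : q ≠ 0) (I : Finset (Fin n)) (t c : ℂ) {i j : Fin n} (hij : i ≠ j) :
    shiftHom hq I (phi t c i j) = phi t (c * (posFactor q I i / posFactor q I j)) i j := by
  rw [phi, phi]
  split_ifs with h
  · rw [map_mul, shiftHom_theta hq I h, shiftHom_inv_theta hq I h, mul_inv c, inv_div, mul_assoc]
  · have h := lt_of_le_of_ne (not_lt.1 h) hij.symm
    rw [map_mul, shiftHom_theta hq I h, shiftHom_inv_theta hq I h, mul_assoc]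

theorem shiftHom_coeffB (hq : q ≠ 0) (I J : Finset (Fin n)) (t : ℂ) :
    shiftHom hq I (coeffB t J) =
      ∏ i ∈ J, ∏ j ∈ Jᶜ, phi t (posFactor q I i / posFactor q I j) i j := by
  rw [coeffB_eq_prod_phi, map_prod]
  refine Finset.prod_congr rfl fun i hi => ?_
  rw [map_prod]
  refine Finset.prod_congr rfl fun j hj => ?_
  rw [shiftHom_phi hq I t 1, one_mul]
  rintro rfl
  exact Finset.mem_compl.1 hj hi

/-- For `i ∈ J` the terms of the commutator cancel individually: shifting `x_i` changes in `𝓑_J`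
only the ratios of `x_i` to variables outside `J`, and shifting all of `J` changes in `𝓑_{i}` the
same ratios by the same factor. -/
theorem coeffB_mul_shift_of_mem (hq : q ≠ 0) (t : ℂ) {i : Fin n} {J : Finset (Fin n)}
    (hi : i ∈ J) :
    coeffB t {i} * shiftHom hq {i} (coeffB t J) = coeffB t J * shiftHom hq J (coeffB t {i}) := by
  have hcompl : ({i} : Finset (Fin n))ᶜ = J.erase i ∪ Jᶜ := by
    ext k
    simp only [Finset.mem_compl, Finset.mem_singleton, Finset.mem_union, Finset.mem_erase]
    by_cases h : k = i
    · subst h; simp [hi]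
    · simp [h, em]
  have hdisj : Disjoint (J.erase i) Jᶜ :=
    Finset.disjoint_left.2 fun k hk hk' => Finset.mem_compl.1 hk' (Finset.mem_of_mem_erase hk)
  rw [shiftHom_coeffB, shiftHom_coeffB, coeffB_eq_prod_phi, coeffB_eq_prod_phi,
    Finset.prod_singleton, Finset.prod_singleton, hcompl, Finset.prod_union hdisj,
    Finset.prod_union hdisj, ← Finset.mul_prod_erase J _ hi, ← Finset.mul_prod_erase J _ hi]
  have e1 : ∏ j ∈ Jᶜ, phi t (posFactor q {i} i / posFactor q {i} j) i j =
      ∏ j ∈ Jᶜ, phi t q i j := by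
    refine Finset.prod_congr rfl fun j hj => ?_
    have hji : j ≠ i := fun h => Finset.mem_compl.1 hj (h ▸ hi)
    simp [posFactor, hji]
  have e2 : ∏ k ∈ J.erase i, ∏ j ∈ Jᶜ, phi t (posFactor q {i} k / posFactor q {i} j) k j =
      ∏ k ∈ J.erase i, ∏ j ∈ Jᶜ, phi t 1 k j := by
    refine Finset.prod_congr rfl fun k hk => Finset.prod_congr rfl fun j hj => ?_
    have hji : j ≠ i := fun h => Finset.mem_compl.1 hj (h ▸ hi)
    simp [posFactor, hji, Finset.ne_of_mem_erase hk]
  have e3 : ∏ j ∈ J.erase i, phi t (posFactor q J i / posFactor q J j) i j =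
      ∏ j ∈ J.erase i, phi t 1 i j := by
    refine Finset.prod_congr rfl fun j hj => ?_
    simp [posFactor, hi, Finset.mem_of_mem_erase hj, hq]
  have e4 : ∏ j ∈ Jᶜ, phi t (posFactor q J i / posFactor q J j) i j =
      ∏ j ∈ Jᶜ, phi t q i j := by
    refine Finset.prod_congr rfl fun j hj => ?_
    simp [posFactor, hi, Finset.mem_compl.1 hj]
  rw [e1, e2, e3, e4]
  ring

/-- The factors linking `K` to its complement are unshifted and do not depend on `i`; only factors
inside `K` remember which element was split off. The opposite composition, treated next, has the
same outer factor, so commutativity reduces to an identity within `K`. -/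
theorem coeffB_singleton_mul_shift_erase (hq : q ≠ 0) (t : ℂ) {i : Fin n} {K : Finset (Fin n)}
    (hi : i ∈ K) :
    coeffB t {i} * shiftHom hq {i} (coeffB t (K.erase i)) =
      (∏ k ∈ K, ∏ j ∈ Kᶜ, phi t 1 k j) *
        ∏ j ∈ K.erase i, phi t 1 i j * phi t q⁻¹ j i := by
  have hcompl : ({i} : Finset (Fin n))ᶜ = K.erase i ∪ Kᶜ := by
    ext k
    simp only [Finset.mem_compl, Finset.mem_singleton, Finset.mem_union, Finset.mem_erase]
    by_cases h : k = i
    · subst h; simp [hi]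
    · simp [h, em]
  have hdisj : Disjoint (K.erase i) Kᶜ :=
    Finset.disjoint_left.2 fun k hk hk' => Finset.mem_compl.1 hk' (Finset.mem_of_mem_erase hk)
  have hcompl' : (K.erase i)ᶜ = insert i Kᶜ := Finset.compl_erase
  have hni : i ∉ Kᶜ := fun h => Finset.mem_compl.1 h hi
  rw [shiftHom_coeffB, coeffB_eq_prod_phi, Finset.prod_singleton, hcompl, hcompl',
    Finset.prod_union hdisj, ← Finset.mul_prod_erase K _ hi]
  have e1 : ∏ k ∈ K.erase i, ∏ j ∈ insert i Kᶜ, phi t (posFactor q {i} k / posFactor q {i} j) k j =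
      (∏ k ∈ K.erase i, phi t q⁻¹ k i) * ∏ k ∈ K.erase i, ∏ j ∈ Kᶜ, phi t 1 k j := by
    rw [← Finset.prod_mul_distrib]
    refine Finset.prod_congr rfl fun k hk => ?_
    have hki : posFactor q {i} k = 1 :=
      if_neg fun h => Finset.ne_of_mem_erase hk (Finset.mem_singleton.1 h)
    have hii : posFactor q {i} i = q := if_pos (Finset.mem_singleton_self i)
    rw [Finset.prod_insert hni, hki, hii, one_div]
    refine congrArg _ (Finset.prod_congr rfl fun j hj => ?_)
    have hji : posFactor q {i} j = 1 :=
      if_neg fun h => hni (by rwa [Finset.mem_singleton.1 h] at hj)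
    rw [hji, div_one]
  rw [e1, Finset.prod_mul_distrib]
  ring

theorem coeffB_erase_mul_shift_singleton (hq : q ≠ 0) (t : ℂ) {i : Fin n} {K : Finset (Fin n)}
    (hi : i ∈ K) :
    coeffB t (K.erase i) * shiftHom hq (K.erase i) (coeffB t {i}) =
      (∏ k ∈ K, ∏ j ∈ Kᶜ, phi t 1 k j) *
        ∏ j ∈ K.erase i, phi t 1 j i * phi t q⁻¹ i j := by
  have hcompl : ({i} : Finset (Fin n))ᶜ = K.erase i ∪ Kᶜ := by
    ext k
    simp only [Finset.mem_compl, Finset.mem_singleton, Finset.mem_union, Finset.mem_erase]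
    by_cases h : k = i
    · subst h; simp [hi]
    · simp [h, em]
  have hdisj : Disjoint (K.erase i) Kᶜ :=
    Finset.disjoint_left.2 fun k hk hk' => Finset.mem_compl.1 hk' (Finset.mem_of_mem_erase hk)
  have hcompl' : (K.erase i)ᶜ = insert i Kᶜ := Finset.compl_erase
  have hni : i ∉ Kᶜ := fun h => Finset.mem_compl.1 h hi
  rw [shiftHom_coeffB, coeffB_eq_prod_phi, Finset.prod_singleton, hcompl, hcompl',
    Finset.prod_union hdisj, ← Finset.mul_prod_erase K _ hi]
  have e1 : ∏ k ∈ K.erase i, ∏ j ∈ insert i Kᶜ, phi t 1 k j =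
      (∏ k ∈ K.erase i, phi t 1 k i) * ∏ k ∈ K.erase i, ∏ j ∈ Kᶜ, phi t 1 k j := by
    rw [← Finset.prod_mul_distrib]
    exact Finset.prod_congr rfl fun k hk => Finset.prod_insert hni
  have e2 : ∏ j ∈ K.erase i, phi t (posFactor q (K.erase i) i / posFactor q (K.erase i) j) i j =
      ∏ j ∈ K.erase i, phi t q⁻¹ i j := by
    refine Finset.prod_congr rfl fun j hj => ?_
    rw [posFactor, posFactor, if_pos hj, if_neg (Finset.notMem_erase i K), one_div]
  have e3 : ∏ j ∈ Kᶜ, phi t (posFactor q (K.erase i) i / posFactor q (K.erase i) j) i j =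
      ∏ j ∈ Kᶜ, phi t 1 i j := by
    refine Finset.prod_congr rfl fun j hj => ?_
    rw [posFactor, posFactor, if_neg (Finset.notMem_erase i K),
      if_neg fun h => Finset.mem_compl.1 hj (Finset.mem_of_mem_erase h), div_one]
  rw [e1, e2, e3, Finset.prod_mul_distrib]
  ring

end Phi

end Ruijsenaars

/-! ### The theta identity in the ring of power series -/

namespace Ruijsenaars

open MvPowerSeries

instance instCharZeroFrac {n : ℕ} : CharZero (Frac n) :=
  charZero_of_injective_algebraMap (R := ℂ)
    ((toFrac.comp (C : ℂ →+* MvPowerSeries (Fin n) ℂ)).injective)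

section ThetaIdentity

variable {n : ℕ} [NeZero n]

/-- The ring of formal power series inside a field on which theta functions of all ratios of
positions are defined. -/
noncomputable def embed : MvPowerSeries (Fin n) ℂ →+* FractionRing (PowerSeries (Frac n)) :=
  (algebraMap _ _).comp slice

theorem embed_injective : Function.Injective (embed (n := n)) :=
  (IsFractionRing.injective _ _).comp slice_injective

theorem embed_theta_mul_inv {i j : Fin n} (hij : i < j) (a c : ℂˣ) :
    embed (theta (a : ℂ) i j * (theta (c : ℂ) i j)⁻¹) =
      jacFrac (Frac n) (constUnit a * (position j / position i)) /
        jacFrac (Frac n) (constUnit c * (position j / position i)) := by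
  have hκ : algebraMap _ (FractionRing (PowerSeries (Frac n))) (thetaConst n) ≠ 0 :=
    (map_ne_zero_iff _ (IsFractionRing.injective _ _)).2 thetaConst_ne_zero
  rw [jacFrac, jacFrac, ← thetaConst_mul_slice_theta hij.le, ← thetaConst_mul_slice_theta hij.le,
    map_mul (algebraMap _ _), map_mul (algebraMap _ _), mul_div_mul_left _ _ hκ, map_mul,
    map_inv_of_constantCoeff embed (by rw [constantCoeff_theta hij]; exact one_ne_zero)]
  rfl

theorem embed_phi_of_lt {i j : Fin n} (hij : i < j) (t c : ℂˣ) :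
    embed (phi (t : ℂ) (c : ℂ) i j) =
      jacFrac (Frac n) (constUnit t * (constUnit c * (position i / position j)))⁻¹ /
        jacFrac (Frac n) (constUnit c * (position i / position j))⁻¹ := by
  have h := embed_theta_mul_inv hij (t⁻¹ * c⁻¹) c⁻¹
  simp only [Units.val_mul, Units.val_inv_eq_inv_val, map_mul, map_inv] at h
  rw [phi, if_pos hij, map_mul, h]
  simp only [mul_inv, inv_div, mul_assoc]

theorem embed_phi_of_gt {i j : Fin n} (hij : j < i) (t c : ℂˣ) :
    embed (phi (t : ℂ) (c : ℂ) i j) =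
      jacFrac (Frac n) (constUnit t * (constUnit c * (position i / position j))) /
        jacFrac (Frac n) (constUnit c * (position i / position j)) := by
  have h := embed_theta_mul_inv hij (t * c) c
  simp only [Units.val_mul, map_mul, mul_assoc] at h
  rw [phi, if_neg hij.not_gt, map_mul, h]

/-- For `i < j` the ratio `x_j / x_i` is a power series without constant term, so no constant
multiple of it is `1`. This supplies the distinctness conditions of the partial fractions. -/
theorem constUnit_mul_position_ne {i j : Fin n} (hij : i ≠ j) (c : ℂˣ) :
    constUnit c * position i ≠ position j := by
  have key : ∀ {i j : Fin n}, i < j → ∀ c : ℂˣ, constUnit c * (position j / position i) ≠ 1 := by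
    intro i j hij c h
    have h1 := val_constUnit_mul_position_div hij.le c
    rw [h, Units.val_one, ← map_one toFrac] at h1
    have h2 := congrArg constantCoeff (IsFractionRing.injective _ (Frac n) h1)
    rw [map_one, map_mul, constantCoeff_ratio hij, mul_zero] at h2
    exact one_ne_zero h2
  intro h
  rcases lt_or_gt_of_ne hij with h0 | h0
  · apply key h0 c⁻¹
    rw [← h, mul_div_cancel_right, map_inv, inv_mul_cancel]
  · apply key h0 c
    rw [← h, mul_comm _ (position i), div_mul_cancel_left, mul_inv_cancel]

/-- Depending on the order of `i` and `j`, `phi` has all four theta arguments inverted or none; the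
quotient is insensitive to this by `IsTheta.thetaQuotient_inv`. -/
theorem embed_phi_mul_phi {q t : ℂˣ} {i j : Fin n} (hij : i ≠ j) :
    embed (phi (t : ℂ) 1 i j * phi (t : ℂ) (q : ℂ)⁻¹ j i) =
      thetaQuotient (jacFrac (Frac n)) (constUnit q) (constUnit t) (position i / position j) := by
  have hv : (position j / position i : (Frac n)ˣ) = (position i / position j)⁻¹ :=
    (inv_div _ _).symm
  have hone : ((1 : ℂˣ) : ℂ) = 1 := rfl
  have e : ∀ v : (Frac n)ˣ, constUnit t * ((constUnit q)⁻¹ * v⁻¹) =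
      (constUnit q / constUnit t * v)⁻¹ := fun v => by
    rw [mul_inv, inv_div, div_eq_mul_inv, mul_assoc]
  have e' : ∀ v : (Frac n)ˣ, (constUnit q)⁻¹ * v⁻¹ = (constUnit q * v)⁻¹ := fun v =>
    (mul_inv _ _).symm
  rw [map_mul, ← hone, ← Units.val_inv_eq_inv_val]
  rcases lt_or_gt_of_ne hij with h | h
  · rw [embed_phi_of_lt h, embed_phi_of_gt h, hv, map_one, one_mul, map_inv, e, e',
      ← (isTheta_jacFrac (Frac n)).thetaQuotient_inv, div_mul_div_comm, mul_comm (jacFrac _ _)]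
  · rw [embed_phi_of_gt h, embed_phi_of_lt h, hv, map_one, one_mul, map_inv, e, e', inv_inv,
      inv_inv, thetaQuotient, div_mul_div_comm]

theorem sum_prod_phi {q t : ℂ} (hq0 : q ≠ 0) (hq1 : q ≠ 1) (ht : t ≠ 0) (K : Finset (Fin n)) :
    ∑ i ∈ K, ∏ j ∈ K.erase i, phi t 1 i j * phi t q⁻¹ j i =
      ∑ i ∈ K, ∏ j ∈ K.erase i, phi t 1 j i * phi t q⁻¹ i j := by
  lift q to ℂˣ using hq0.isUnit
  lift t to ℂˣ using ht.isUnit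
  apply embed_injective
  rw [map_sum, map_sum]
  have hQ : (constUnit q : (Frac n)ˣ) ≠ 1 := by
    intro h
    have h1 := congrArg Units.val h
    apply hq1
    exact (toFrac.comp (C : ℂ →+* MvPowerSeries (Fin n) ℂ)).injective
      (h1.trans (map_one _).symm)
  have key := (isTheta_jacFrac (Frac n)).sum_prod_thetaQuotient (constUnit t) hQ position K
    (fun i _ j _ hij h => constUnit_mul_position_ne hij 1 (by rw [map_one, one_mul, h]))
    (fun i _ j _ hij => constUnit_mul_position_ne hij q)
  convert key using 1
  · refine Finset.sum_congr rfl fun i _ => ?_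
    rw [map_prod]
    exact Finset.prod_congr rfl fun j hj => embed_phi_mul_phi (Finset.ne_of_mem_erase hj).symm
  · refine Finset.sum_congr rfl fun i _ => ?_
    rw [map_prod]
    exact Finset.prod_congr rfl fun j hj => embed_phi_mul_phi (Finset.ne_of_mem_erase hj)

end ThetaIdentity

end Ruijsenaars

/-! ### The first operator commutes with all others -/

namespace Ruijsenaars

open MvPowerSeries

theorem sum_powersetCard_sum_compl {n : ℕ} {M : Type*} [AddCommMonoid M] (r : ℕ)
    (g : Fin n → Finset (Fin n) → M) :
    ∑ J ∈ Finset.powersetCard r (Finset.univ : Finset (Fin n)), ∑ i ∈ Jᶜ, g i J =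
      ∑ K ∈ Finset.powersetCard (r + 1) (Finset.univ : Finset (Fin n)),
        ∑ i ∈ K, g i (K.erase i) := by
  rw [Finset.sum_sigma', Finset.sum_sigma']
  refine Finset.sum_bij' (fun x _ => ⟨insert x.2 x.1, x.2⟩) (fun x _ => ⟨x.1.erase x.2, x.2⟩)
    ?_ ?_ ?_ ?_ ?_
  · rintro ⟨J, i⟩ h
    simp only [Finset.mem_sigma, Finset.mem_powersetCard, Finset.subset_univ, true_and,
      Finset.mem_compl] at h ⊢
    exact ⟨by rw [Finset.card_insert_of_notMem h.2, h.1], Finset.mem_insert_self _ _⟩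
  · rintro ⟨K, i⟩ h
    simp only [Finset.mem_sigma, Finset.mem_powersetCard, Finset.subset_univ, true_and,
      Finset.mem_compl] at h ⊢
    exact ⟨by rw [Finset.card_erase_of_mem h.2, h.1, Nat.add_sub_cancel], Finset.notMem_erase _ _⟩
  · rintro ⟨J, i⟩ h
    simp only [Finset.mem_sigma, Finset.mem_compl] at h
    simp [Finset.erase_insert h.2]
  · rintro ⟨K, i⟩ h
    simp only [Finset.mem_sigma] at h
    simp [Finset.insert_erase h.2]
  · rintro ⟨J, i⟩ h
    simp only [Finset.mem_sigma, Finset.mem_compl] at h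
    simp [Finset.erase_insert h.2]

section Commute

variable {n : ℕ} [NeZero n] {q : ℂ}

theorem qShift_comm (q : ℂ) (I J : Finset (Fin n)) (f : MvPowerSeries (Fin n) ℂ) :
    qShift q I (qShift q J f) = qShift q J (qShift q I f) := by
  ext d
  simp only [coeff_qShift]
  ring

theorem qShift_singleton_erase (q : ℂ) {i : Fin n} {K : Finset (Fin n)} (hi : i ∈ K)
    (f : MvPowerSeries (Fin n) ℂ) :
    qShift q {i} (qShift q (K.erase i) f) = qShift q K f := by
  ext d
  rw [coeff_qShift, coeff_qShift, coeff_qShift, ← mul_assoc, shiftFactor, shiftFactor, shiftFactor, Finset.prod_singleton,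
    Finset.mul_prod_erase K (fun i => q ^ xExponent d i) hi]

theorem modifiedOperator_modifiedOperator (hq : q ≠ 0) (t : ℂ) (s : Fin n → ℂ) (r l : ℕ)
    (f : MvPowerSeries (Fin n) ℂ) :
    modifiedOperator q t s r (modifiedOperator q t s l f) =
      ∑ I ∈ Finset.powersetCard r Finset.univ, ∑ J ∈ Finset.powersetCard l Finset.univ,
        C ((∏ i ∈ I, s i) * ∏ j ∈ J, s j) * (coeffB t I * shiftHom hq I (coeffB t J)) *
          qShift q I (qShift q J f) := by
  unfold modifiedOperator
  refine Finset.sum_congr rfl fun I _ => ?_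
  rw [← shiftHom_apply hq, map_sum, Finset.mul_sum]
  refine Finset.sum_congr rfl fun J _ => ?_
  rw [map_mul, map_mul, shiftHom_C, shiftHom_apply, shiftHom_apply, map_mul C]
  ring

theorem modifiedOperator_one_comm (hq0 : q ≠ 0) (hq1 : q ≠ 1) {t : ℂ} (ht : t ≠ 0)
    (s : Fin n → ℂ) (r : ℕ) (f : MvPowerSeries (Fin n) ℂ) :
    modifiedOperator q t s 1 (modifiedOperator q t s r f) =
      modifiedOperator q t s r (modifiedOperator q t s 1 f) := by
  rw [modifiedOperator_modifiedOperator hq0, modifiedOperator_modifiedOperator hq0,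
    Finset.sum_comm]
  have hone : ∀ g : Finset (Fin n) → MvPowerSeries (Fin n) ℂ,
      ∑ I ∈ Finset.powersetCard 1 Finset.univ, g I = ∑ i, g {i} := fun g => by
    simp [Finset.powersetCard_one]
  simp only [hone, Finset.prod_singleton]
  have hsplit : ∀ (J : Finset (Fin n)) (g : Fin n → MvPowerSeries (Fin n) ℂ),
      ∑ i, g i = ∑ i ∈ J, g i + ∑ i ∈ Jᶜ, g i := fun J g =>
    (Finset.sum_add_sum_compl J g).symm
  rw [Finset.sum_congr rfl fun J _ => hsplit J _, Finset.sum_add_distrib,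
    Finset.sum_congr rfl fun J _ => hsplit J
      (fun i => C ((∏ j ∈ J, s j) * s i) * (coeffB t J * shiftHom hq0 J (coeffB t {i})) *
          qShift q J (qShift q {i} f)), Finset.sum_add_distrib]
  -- Pairs with `i ∈ J` agree term by term. Pairs with `i ∉ J` are regrouped by `K = insert i J`,
  -- where only the sum over `i ∈ K` agrees.
  refine congrArg₂ (· + ·) ?_ ?_
  · refine Finset.sum_congr rfl fun J _ => Finset.sum_congr rfl fun i hi => ?_
    rw [coeffB_mul_shift_of_mem hq0 t hi, qShift_comm, mul_comm (s i)]
  · rw [sum_powersetCard_sum_compl r (fun i J => C (s i * ∏ j ∈ J, s j) *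
        (coeffB t {i} * shiftHom hq0 {i} (coeffB t J)) * qShift q {i} (qShift q J f)),
      sum_powersetCard_sum_compl r (fun i J => C ((∏ j ∈ J, s j) * s i) *
        (coeffB t J * shiftHom hq0 J (coeffB t {i})) * qShift q J (qShift q {i} f))]
    refine Finset.sum_congr rfl fun K _ => ?_
    have h1 : ∀ i ∈ K, C (s i * ∏ j ∈ K.erase i, s j) *
        (coeffB t {i} * shiftHom hq0 {i} (coeffB t (K.erase i))) *
          qShift q {i} (qShift q (K.erase i) f) =
        (C (∏ j ∈ K, s j) * (∏ k ∈ K, ∏ j ∈ Kᶜ, phi t 1 k j) * qShift q K f) *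
          ∏ j ∈ K.erase i, phi t 1 i j * phi t q⁻¹ j i := fun i hi => by
      rw [coeffB_singleton_mul_shift_erase hq0 t hi, Finset.mul_prod_erase K s hi,
        qShift_singleton_erase q hi]
      ring
    have h2 : ∀ i ∈ K, C ((∏ j ∈ K.erase i, s j) * s i) *
        (coeffB t (K.erase i) * shiftHom hq0 (K.erase i) (coeffB t {i})) *
          qShift q (K.erase i) (qShift q {i} f) =
        (C (∏ j ∈ K, s j) * (∏ k ∈ K, ∏ j ∈ Kᶜ, phi t 1 k j) * qShift q K f) *
          ∏ j ∈ K.erase i, phi t 1 j i * phi t q⁻¹ i j := fun i hi => by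
      rw [coeffB_erase_mul_shift_singleton hq0 t hi, Finset.prod_erase_mul K s hi, qShift_comm,
        qShift_singleton_erase q hi]
      ring
    rw [Finset.sum_congr rfl h1, Finset.sum_congr rfl h2, ← Finset.mul_sum, ← Finset.mul_sum,
      sum_prod_phi hq0 hq1 ht]

end Commute

end Ruijsenaars

/-! ### Coefficient recursion and the subring of power series in the nome -/

namespace Ruijsenaars

open MvPowerSeries

section Coefficients

variable {n : ℕ}

theorem coeff_mul_of_coeff_lt_left {d : Fin n →₀ ℕ} {f g : MvPowerSeries (Fin n) ℂ}
    (h : ∀ e < d, coeff e f = 0) : coeff d (f * g) = coeff d f * constantCoeff g := by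
  classical
  rw [coeff_mul, Finset.sum_eq_single (d, 0)]
  · rw [coeff_zero_eq_constantCoeff_apply]
  · rintro ⟨a, b⟩ hab hne
    have hab := Finset.HasAntidiagonal.mem_antidiagonal.1 hab
    have hle : a ≤ d := hab ▸ le_self_add
    have hlt : a < d := by
      refine lt_of_le_of_ne hle fun h0 => hne ?_
      subst h0
      exact congrArg (Prod.mk a) (add_eq_left.1 hab)
    rw [h a hlt, zero_mul]
  · intro h0
    exact absurd (Finset.HasAntidiagonal.mem_antidiagonal.2 (add_zero d)) h0

theorem coeff_mul_of_coeff_lt_right {d : Fin n →₀ ℕ} {f g : MvPowerSeries (Fin n) ℂ}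
    (h : ∀ e < d, coeff e g = 0) : coeff d (f * g) = constantCoeff f * coeff d g := by
  rw [mul_comm, coeff_mul_of_coeff_lt_left h, mul_comm]

/-- A map on power series for which the coefficients of the image depend only on lower
coefficients of the argument has a fixed point. -/
theorem exists_eq_self_of_causal (Φ : MvPowerSeries (Fin n) ℂ → MvPowerSeries (Fin n) ℂ)
    (hΦ : ∀ f g d, (∀ e < d, coeff e f = coeff e g) → coeff d (Φ f) = coeff d (Φ g)) :
    ∃ f, Φ f = f := by
  classical
  have wf : WellFounded ((· < ·) : (Fin n →₀ ℕ) → (Fin n →₀ ℕ) → Prop) := wellFounded_lt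
  let step : (d : Fin n →₀ ℕ) → ((e : Fin n →₀ ℕ) → e < d → ℂ) → ℂ := fun d rec =>
    coeff d (Φ fun e => if h : e < d then rec e h else 0)
  let f : MvPowerSeries (Fin n) ℂ := fun d => wf.fix step d
  refine ⟨f, ?_⟩
  ext d
  have h1 : coeff d f = step d fun e _ => wf.fix step e := wf.fix_eq step d
  rw [h1]
  refine hΦ _ _ d fun e he => ?_
  change _ = dite (e < d) _ _
  rw [dif_pos he]
  rfl

theorem diag_zero : diag n 0 = 0 := by
  ext i
  rfl

variable [NeZero n]

theorem diag_injective : Function.Injective (diag n) := fun k l h => by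
  have := DFunLike.congr_fun h 0
  simpa [diag_apply] using this

theorem coeff_ofNome_diag (γ : PowerSeries ℂ) (k : ℕ) :
    coeff (diag n k) (ofNome γ) = PowerSeries.coeff k γ := by
  classical
  rw [ofNome, PowerSeries.coeff_subst (hasSubst_nome n), finsum_eq_single _ k]
  · rw [coeff_nome_pow, if_pos rfl, smul_eq_mul, mul_one]
  · intro l hl
    rw [coeff_nome_pow, if_neg fun h => hl (diag_injective h).symm, smul_zero]

theorem coeff_ofNome_of_ne (γ : PowerSeries ℂ) {d : Fin n →₀ ℕ} (hd : ∀ k, d ≠ diag n k) :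
    coeff d (ofNome γ) = 0 := by
  classical
  rw [ofNome, PowerSeries.coeff_subst (hasSubst_nome n)]
  refine finsum_eq_zero_of_forall_eq_zero fun l => ?_
  rw [coeff_nome_pow, if_neg (hd l), smul_zero]

theorem ofNome_injective : Function.Injective (ofNome (n := n)) := fun γ δ h => by
  ext k
  rw [← coeff_ofNome_diag (n := n), h, coeff_ofNome_diag]

theorem ofNome_mul (γ δ : PowerSeries ℂ) :
    (ofNome (γ * δ) : MvPowerSeries (Fin n) ℂ) = ofNome γ * ofNome δ :=
  PowerSeries.subst_mul (hasSubst_nome n) γ δ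

theorem ofNome_add (γ δ : PowerSeries ℂ) :
    (ofNome (γ + δ) : MvPowerSeries (Fin n) ℂ) = ofNome γ + ofNome δ :=
  PowerSeries.subst_add (hasSubst_nome n) γ δ

theorem ofNome_sub (γ δ : PowerSeries ℂ) :
    (ofNome (γ - δ) : MvPowerSeries (Fin n) ℂ) = ofNome γ - ofNome δ := by
  rw [eq_sub_iff_add_eq, ← ofNome_add, sub_add_cancel]

theorem ofNome_zero : (ofNome 0 : MvPowerSeries (Fin n) ℂ) = 0 := by
  rw [← sub_self (0 : PowerSeries ℂ), ofNome_sub, sub_self]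

theorem constantCoeff_ofNome (γ : PowerSeries ℂ) :
    constantCoeff (ofNome γ : MvPowerSeries (Fin n) ℂ) = PowerSeries.constantCoeff γ := by
  rw [← coeff_zero_eq_constantCoeff_apply, ← diag_zero, coeff_ofNome_diag,
    PowerSeries.coeff_zero_eq_constantCoeff_apply]

/-- If `diag n k = diag n j + b`, then `b` is diagonal too, so only the diagonal coefficients of `f`
contribute, and these are those of `1`. -/
theorem coeff_diag_ofNome_mul {f : MvPowerSeries (Fin n) ℂ} (h0 : constantCoeff f = 1)
    (hf : ∀ k, k ≠ 0 → coeff (diag n k) f = 0) (γ : PowerSeries ℂ) (k : ℕ) :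
    coeff (diag n k) (ofNome γ * f) = PowerSeries.coeff k γ := by
  classical
  rw [coeff_mul, Finset.sum_eq_single (diag n k, 0)]
  · rw [coeff_zero_eq_constantCoeff_apply, h0, coeff_ofNome_diag, mul_one]
  · rintro ⟨a, b⟩ hab hne
    have hab := Finset.HasAntidiagonal.mem_antidiagonal.1 hab
    dsimp only at hab ⊢
    by_cases ha : ∃ j, a = diag n j
    · obtain ⟨j, rfl⟩ := ha
      have hi : ∀ i, j + b i = k := fun i => by
        have := DFunLike.congr_fun hab i
        simpa [diag_apply] using this
      have hb : b = diag n (k - j) := by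
        ext i
        rw [diag_apply, ← hi i, Nat.add_sub_cancel_left]
      have hkj : k - j ≠ 0 := by
        intro h0
        apply hne
        have : j = k := by have := hi 0; omega
        rw [this, hb, h0, diag_zero]
      rw [hb, hf _ hkj, mul_zero]
    · rw [coeff_ofNome_of_ne γ (fun j hj => ha ⟨j, hj⟩), zero_mul]
  · intro h
    exact absurd (Finset.HasAntidiagonal.mem_antidiagonal.2 (add_zero _)) h

end Coefficients

/-! ### Eigenfunctions of nonresonant triangular operators -/

section Eigenfunction

variable {n : ℕ} [NeZero n]

/-- A linear operator over the power series in the nome that is triangular with respect to the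
monomials, with diagonal entries `lam`, and such that `lam d = lam 0` only if `z ^ d` is a
power of the nome. -/
structure IsNonresonant (L : MvPowerSeries (Fin n) ℂ → MvPowerSeries (Fin n) ℂ)
    (lam : (Fin n →₀ ℕ) → ℂ) : Prop where
  map_sub : ∀ f g, L (f - g) = L f - L g
  map_ofNome_mul : ∀ γ f, L (ofNome γ * f) = ofNome γ * L f
  coeff_eq : ∀ f d, (∀ e < d, coeff e f = 0) → coeff d (L f) = lam d * coeff d f
  exists_eq_diag : ∀ d, lam d = lam 0 → ∃ k, d = diag n k

variable {L : MvPowerSeries (Fin n) ℂ → MvPowerSeries (Fin n) ℂ} {lam : (Fin n →₀ ℕ) → ℂ}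

/-- Induction on `d`: once the lower coefficients of `h` and `κ` vanish, the equation at `d` reads
`lam d * h_d = lam 0 * h_d + κ_d`. On the diagonal `h_d = 0` gives `κ_d = 0`; off the diagonal `κ_d
= 0` and nonresonance gives `h_d = 0`. -/
theorem IsNonresonant.eq_zero (hL : IsNonresonant L lam) {f h : MvPowerSeries (Fin n) ℂ}
    {η κ : PowerSeries ℂ} (hη : PowerSeries.constantCoeff η = lam 0) (hf : constantCoeff f = 1)
    (hh : ∀ k, coeff (diag n k) h = 0) (heq : L h = ofNome η * h + ofNome κ * f) :
    h = 0 ∧ κ = 0 := by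
  have key : ∀ d, coeff d h = 0 ∧ coeff d (ofNome κ : MvPowerSeries (Fin n) ℂ) = 0 := by
    intro d
    induction d using WellFoundedLT.induction with
    | ind d ih =>
      have h1 := congrArg (coeff d) heq
      rw [hL.coeff_eq h d fun e he => (ih e he).1, _root_.map_add,
        coeff_mul_of_coeff_lt_right fun e he => (ih e he).1,
        coeff_mul_of_coeff_lt_left fun e he => (ih e he).2, constantCoeff_ofNome, hη, hf,
        mul_one] at h1
      by_cases hd : ∃ k, d = diag n k
      · obtain ⟨k, rfl⟩ := hd
        rw [hh k, mul_zero, mul_zero, zero_add] at h1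
        exact ⟨hh k, h1.symm⟩
      · have h2 := coeff_ofNome_of_ne κ (fun k hk => hd ⟨k, hk⟩)
        rw [h2, add_zero, ← sub_eq_zero, ← sub_mul, mul_eq_zero, sub_eq_zero] at h1
        exact ⟨h1.resolve_left fun h0 => hd (hL.exists_eq_diag d h0), h2⟩
  refine ⟨MvPowerSeries.ext fun d => (key d).1, ofNome_injective (n := n) ?_⟩
  rw [ofNome_zero]
  exact MvPowerSeries.ext fun d => (key d).2

/-- A nonresonant operator has an eigenfunction whose part in the powers of the nome is `1`. -/
theorem IsNonresonant.exists_eigenfunction (hL : IsNonresonant L lam) :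
    ∃ (f : MvPowerSeries (Fin n) ℂ) (ε : PowerSeries ℂ), constantCoeff f = 1 ∧
      (∀ k, k ≠ 0 → coeff (diag n k) f = 0) ∧ PowerSeries.constantCoeff ε = lam 0 ∧
      L f = ofNome ε * f := by
  classical
  -- The eigenvalue is read off from the diagonal coefficients of `L f`. Its constant term is
  -- prescribed as `lam 0`, because the cancellation below must hold for every argument of `Φ`, not
  -- only for those with constant term `1`.
  let ε : MvPowerSeries (Fin n) ℂ → PowerSeries ℂ := fun f =>
    PowerSeries.mk fun k => if k = 0 then lam 0 else coeff (diag n k) (L f)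
  let S : MvPowerSeries (Fin n) ℂ → MvPowerSeries (Fin n) ℂ := fun f => ofNome (ε f) * f - L f
  let Φ : MvPowerSeries (Fin n) ℂ → MvPowerSeries (Fin n) ℂ := fun f d =>
    if ∃ k, d = diag n k then (if d = 0 then 1 else 0)
    else coeff d f + coeff d (S f) / (lam d - lam 0)
  have hε : ∀ f, PowerSeries.constantCoeff (ε f) = lam 0 := fun f => by
    rw [← PowerSeries.coeff_zero_eq_constantCoeff_apply, PowerSeries.coeff_mk, if_pos rfl]
  have hΦ : ∀ f d, coeff d (Φ f) = if ∃ k, d = diag n k then (if d = 0 then 1 else 0)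
    else coeff d f + coeff d (S f) / (lam d - lam 0) := fun f d => rfl
  obtain ⟨f, hf⟩ := exists_eq_self_of_causal Φ (by
    intro f g d hfg
    rw [hΦ, hΦ]
    split_ifs with hd h0
    · rfl
    · rfl
    -- As `h` vanishes below `d`, only the diagonal entries survive in `S f - S g` at `d`, giving
    -- `(lam 0 - lam d) * h_d`. After division by `lam d - lam 0` this cancels `h_d`, so `Φ` depends
    -- on lower coefficients only.
    set h := f - g with hh
    have hlow : ∀ e < d, coeff e h = 0 := fun e he => by
      rw [hh, _root_.map_sub, hfg e he, sub_self]
    have hδ : ∀ e ≤ d, coeff e (ofNome (ε f - ε g) : MvPowerSeries (Fin n) ℂ) = 0 := by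
      intro e he
      by_cases hek : ∃ k, e = diag n k
      · obtain ⟨k, rfl⟩ := hek
        have hlt : diag n k < d := lt_of_le_of_ne he fun h0 => hd ⟨k, h0.symm⟩
        rw [coeff_ofNome_diag, _root_.map_sub, PowerSeries.coeff_mk, PowerSeries.coeff_mk]
        split_ifs with hk
        · exact sub_self _
        · rw [← _root_.map_sub, ← hL.map_sub, ← hh,
            hL.coeff_eq h _ fun e' he' => hlow e' (he'.trans hlt), hlow _ hlt, mul_zero]
      · exact coeff_ofNome_of_ne _ fun k hk => hek ⟨k, hk⟩
    have hS : S f - S g = ofNome (ε f - ε g) * f + ofNome (ε g) * h - L h := by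
      rw [hh, hL.map_sub, ofNome_sub]
      ring
    have hSd : coeff d (S f) - coeff d (S g) = coeff d (ofNome (ε f - ε g) * f) +
        coeff d (ofNome (ε g) * h) - coeff d (L h) := by
      rw [← _root_.map_sub, hS, _root_.map_sub, _root_.map_add]
    rw [coeff_mul_of_coeff_lt_left fun e he => hδ e he.le, hδ d le_rfl,
      coeff_mul_of_coeff_lt_right hlow, constantCoeff_ofNome, hε, hL.coeff_eq h d hlow, zero_mul,
      zero_add] at hSd
    have hne : lam d - lam 0 ≠ 0 := fun h0 => hd (hL.exists_eq_diag d (sub_eq_zero.1 h0))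
    have hhd : coeff d h = coeff d f - coeff d g := _root_.map_sub _ _ _
    rw [← sub_eq_zero, add_sub_add_comm, ← sub_div, hSd, hhd]
    field_simp
    ring)
  have hfd : ∀ k, coeff (diag n k) f = if k = 0 then 1 else 0 := fun k => by
    rw [← hf, hΦ, if_pos ⟨k, rfl⟩]
    refine if_congr ?_ rfl rfl
    rw [← diag_zero (n := n), diag_injective.eq_iff]
  have hf0 : constantCoeff f = 1 := by
    rw [← coeff_zero_eq_constantCoeff_apply, ← diag_zero, hfd, if_pos rfl]
  have hfk : ∀ k, k ≠ 0 → coeff (diag n k) f = 0 := fun k hk => by rw [hfd, if_neg hk]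
  refine ⟨f, ε f, hf0, hfk, hε f, ?_⟩
  ext d
  by_cases hd : ∃ k, d = diag n k
  · obtain ⟨k, rfl⟩ := hd
    rw [coeff_diag_ofNome_mul hf0 hfk, PowerSeries.coeff_mk]
    split_ifs with hk
    · subst hk
      rw [diag_zero, hL.coeff_eq f 0 (fun e he => absurd he (by simp)),
        coeff_zero_eq_constantCoeff_apply, hf0, mul_one]
    · rfl
  · have h1 := congrArg (coeff d) hf
    rw [hΦ, if_neg hd, add_eq_left, div_eq_zero_iff] at h1
    rcases h1 with h1 | h1
    · exact (sub_eq_zero.1 h1).symm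
    · exact absurd (hL.exists_eq_diag d (sub_eq_zero.1 h1)) hd

/-- Eigenfunctions are unique up to power series in the nome. -/
theorem IsNonresonant.eq_ofNome_mul (hL : IsNonresonant L lam) {f g : MvPowerSeries (Fin n) ℂ}
    {ε η : PowerSeries ℂ} (hf0 : constantCoeff f = 1)
    (hfk : ∀ k, k ≠ 0 → coeff (diag n k) f = 0) (hη : PowerSeries.constantCoeff η = lam 0)
    (hf : L f = ofNome ε * f) (hg : L g = ofNome η * g) :
    ∃ γ : PowerSeries ℂ, g = ofNome γ * f := by
  -- Subtracting the multiple of `f` with the same diagonal coefficients as `g` leaves a series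
  -- without diagonal part, to which `IsNonresonant.eq_zero` applies.
  refine ⟨PowerSeries.mk fun k => coeff (diag n k) g, ?_⟩
  set γ : PowerSeries ℂ := PowerSeries.mk fun k => coeff (diag n k) g with hγ
  have key := hL.eq_zero (f := f) (h := g - ofNome γ * f) (κ := γ * (η - ε)) hη hf0
    (fun k => by rw [_root_.map_sub, coeff_diag_ofNome_mul hf0 hfk, hγ, PowerSeries.coeff_mk,
      sub_self])
    (by
      rw [hL.map_sub, hL.map_ofNome_mul, hf, hg, ofNome_mul, ofNome_sub]
      ring)
  exact sub_eq_zero.1 key.1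

end Eigenfunction

end Ruijsenaars

/-! ### Triangularity and diagonal entries of the modified operators -/

namespace Ruijsenaars

open MvPowerSeries

/-- Countably many finite root sets cannot cover `ℂ`. This makes infinitely many genericity
conditions, one for each exponent `d`, hold at once. -/
theorem exists_forall_eval_ne_zero {ι : Type*} [Countable ι] (P : ι → Polynomial ℂ)
    (hP : ∀ i, P i ≠ 0) : ∃ y, ∀ i, (P i).eval y ≠ 0 := by
  by_contra! h
  have h1 : (Set.univ : Set ℂ) ⊆ ⋃ i, {y | (P i).IsRoot y} := fun y _ =>
    Set.mem_iUnion.2 (h y)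
  have h2 : (⋃ i, {y | (P i).IsRoot y}).Countable :=
    Set.countable_iUnion fun i => (Polynomial.finite_setOfPred_isRoot (hP i)).countable
  exact not_countable_complex (h2.mono h1)

theorem zpow_ne_one_of_norm_lt_one {q : ℂ} (hq1 : ‖q‖ < 1) {m : ℤ} (hm : m ≠ 0) :
    q ^ m ≠ 1 := by
  intro h
  have h1 := congrArg norm h
  rw [norm_zpow, norm_one, zpow_eq_one_iff_right₀ (norm_nonneg q) hq1.ne] at h1
  exact hm h1

section Operators

variable {n : ℕ} [NeZero n] {q : ℂ}

theorem exists_eq_diag_of_xExponent {d : Fin n →₀ ℕ} (h : ∀ i, xExponent d i = 0) :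
    ∃ k, d = diag n k := by
  refine ⟨d 0, ?_⟩
  have key : ∀ (k : ℕ) (hk : k < n), d ⟨k, hk⟩ = d 0 := by
    intro k
    induction k with
    | zero => intro _; rfl
    | succ k ih =>
      intro hk
      have h1 := h ⟨k, by omega⟩
      have h2 : (⟨k, by omega⟩ + 1 : Fin n) = ⟨k + 1, hk⟩ := by
        ext
        rw [Fin.val_add, Fin.val_one', Nat.add_mod_mod]
        exact Nat.mod_eq_of_lt hk
      rw [xExponent, h2] at h1
      have := ih (by omega)
      omega
  ext i
  rw [diag_apply]
  exact key i i.2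

theorem qShift_ofNome_mul (hq : q ≠ 0) (I : Finset (Fin n)) (γ : PowerSeries ℂ)
    (f : MvPowerSeries (Fin n) ℂ) : qShift q I (ofNome γ * f) = ofNome γ * qShift q I f := by
  have h : shiftHom hq I (ofNome γ) = ofNome γ := by
    ext d
    rw [shiftHom_apply, coeff_qShift]
    by_cases hd : ∃ k, d = diag n k
    · obtain ⟨k, rfl⟩ := hd
      rw [shiftFactor_diag, one_mul]
    · rw [coeff_ofNome_of_ne γ fun k hk => hd ⟨k, hk⟩, mul_zero]
  rw [← shiftHom_apply hq, map_mul, h, shiftHom_apply]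

theorem modifiedOperator_ofNome_mul (hq : q ≠ 0) (t : ℂ) (s : Fin n → ℂ) (r : ℕ)
    (γ : PowerSeries ℂ) (f : MvPowerSeries (Fin n) ℂ) :
    modifiedOperator q t s r (ofNome γ * f) = ofNome γ * modifiedOperator q t s r f := by
  rw [modifiedOperator, modifiedOperator, Finset.mul_sum]
  refine Finset.sum_congr rfl fun I _ => ?_
  rw [qShift_ofNome_mul hq]
  ring

theorem modifiedOperator_sub (hq : q ≠ 0) (t : ℂ) (s : Fin n → ℂ) (r : ℕ)
    (f g : MvPowerSeries (Fin n) ℂ) :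
    modifiedOperator q t s r (f - g) = modifiedOperator q t s r f - modifiedOperator q t s r g := by
  rw [modifiedOperator, modifiedOperator, modifiedOperator, ← Finset.sum_sub_distrib]
  refine Finset.sum_congr rfl fun I _ => ?_
  rw [← shiftHom_apply hq, map_sub, shiftHom_apply, shiftHom_apply]
  ring

/-- The diagonal entries of the modified operators, the elementary symmetric functions of
`s_i q ^ μ_i`. -/
noncomputable def diagEntry (q : ℂ) (s : Fin n → ℂ) (r : ℕ) (d : Fin n →₀ ℕ) : ℂ :=
  ∑ I ∈ Finset.powersetCard r (Finset.univ : Finset (Fin n)), ∏ i ∈ I, s i * q ^ xExponent d i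

/-- At a lowest exponent only the constant term `1` of each `𝓑_I` acts, which leaves the shift
factors. -/
theorem coeff_modifiedOperator (q t : ℂ) (s : Fin n → ℂ) (r : ℕ) {f : MvPowerSeries (Fin n) ℂ}
    {d : Fin n →₀ ℕ} (h : ∀ e < d, coeff e f = 0) :
    coeff d (modifiedOperator q t s r f) = diagEntry q s r d * coeff d f := by
  rw [modifiedOperator, map_sum, diagEntry, Finset.sum_mul]
  refine Finset.sum_congr rfl fun I _ => ?_
  rw [coeff_mul_of_coeff_lt_right fun e he => by rw [coeff_qShift, h e he, mul_zero],
    map_mul, constantCoeff_C, constantCoeff_coeffB, mul_one, coeff_qShift, shiftFactor,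
    Finset.prod_mul_distrib, mul_assoc]

/-- Operators over the power series in the nome that commute with a nonresonant operator have
its eigenfunction as an eigenfunction. -/
theorem IsNonresonant.exists_eigenvalue
    {L M : MvPowerSeries (Fin n) ℂ → MvPowerSeries (Fin n) ℂ} {lam : (Fin n →₀ ℕ) → ℂ}
    (hL : IsNonresonant L lam) (hM : ∀ γ f, M (ofNome γ * f) = ofNome γ * M f)
    (hLM : ∀ f, L (M f) = M (L f)) {f : MvPowerSeries (Fin n) ℂ} {ε : PowerSeries ℂ}
    (hf0 : constantCoeff f = 1) (hfk : ∀ k, k ≠ 0 → coeff (diag n k) f = 0)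
    (hε : PowerSeries.constantCoeff ε = lam 0) (hf : L f = ofNome ε * f) :
    ∃ η : PowerSeries ℂ, M f = ofNome η * f :=
  hL.eq_ofNome_mul hf0 hfk hε hf (by rw [hLM, hf, hM])

theorem isNonresonant_modifiedOperator_one (hq : q ≠ 0) (t : ℂ) {s : Fin n → ℂ}
    (hs : ∀ d : Fin n →₀ ℕ, (¬ ∃ k, d = diag n k) → ∑ i, s i * (q ^ xExponent d i - 1) ≠ 0) :
    IsNonresonant (modifiedOperator q t s 1) (diagEntry q s 1) where
  map_sub := modifiedOperator_sub hq t s 1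
  map_ofNome_mul := modifiedOperator_ofNome_mul hq t s 1
  coeff_eq _ _ h := coeff_modifiedOperator q t s 1 h
  exists_eq_diag d h := by
    by_contra hd
    apply hs d hd
    have h1 : ∀ d, diagEntry q s 1 d = ∑ i, s i * q ^ xExponent d i := fun d => by
      simp [diagEntry, Finset.powersetCard_one]
    rw [h1, h1, ← sub_eq_zero, ← Finset.sum_sub_distrib] at h
    rw [← h]
    refine Finset.sum_congr rfl fun i _ => ?_
    simp [xExponent]
    ring

end Operators

end Ruijsenaars

/-! ### Commutativity of all operators by genericity -/

namespace Ruijsenaars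

open MvPowerSeries

variable {n : ℕ}

/-- The number whose ternary digits are the multiplicities of the elements in the union of two
sets. -/
def ternaryCode (p : Finset (Fin n) × Finset (Fin n)) : ℕ :=
  ∑ i ∈ p.1, 3 ^ (i : ℕ) + ∑ i ∈ p.2, 3 ^ (i : ℕ)

/-- Each index occurs `0`, `1` or `2` times in the two sets together, so uniqueness of ternary
digits recovers the multiplicities, and the product depends only on these. -/
theorem prod_mul_prod_eq_of_ternaryCode_eq {p p' : Finset (Fin n) × Finset (Fin n)}
    (h : ternaryCode p = ternaryCode p') (w : Fin n → ℂ) :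
    (∏ i ∈ p.1, w i) * ∏ i ∈ p.2, w i = (∏ i ∈ p'.1, w i) * ∏ i ∈ p'.2, w i := by
  classical
  let ν : Finset (Fin n) × Finset (Fin n) → Fin n → Fin 3 := fun p i =>
    ⟨(if i ∈ p.1 then 1 else 0) + (if i ∈ p.2 then 1 else 0), by split_ifs <;> norm_num⟩
  have hν : ∀ p i, (ν p i : ℕ) = (if i ∈ p.1 then 1 else 0) + (if i ∈ p.2 then 1 else 0) :=
    fun _ _ => rfl
  have h1 : ∀ p, ternaryCode p = (finFunctionFinEquiv (ν p) : ℕ) := fun p => by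
    rw [finFunctionFinEquiv_apply]
    simp only [hν, add_mul, ite_mul, one_mul, zero_mul, Finset.sum_add_distrib,
      Finset.sum_ite_mem, Finset.univ_inter]
    rfl
  have h2 : ∀ p : Finset (Fin n) × Finset (Fin n),
      (∏ i ∈ p.1, w i) * ∏ i ∈ p.2, w i = ∏ i, w i ^ (ν p i : ℕ) := fun p => by
    simp only [hν, pow_add, Finset.prod_mul_distrib, pow_ite, pow_one, pow_zero,
      Finset.prod_ite_mem, Finset.univ_inter]
  rw [h1, h1] at h
  rw [h2, h2, finFunctionFinEquiv.injective (Fin.ext h)]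

variable [NeZero n] {q : ℂ}

/-- The coefficients of the commutator of two modified operators. -/
noncomputable def commCoeff (hq : q ≠ 0) (t : ℂ) (p : Finset (Fin n) × Finset (Fin n)) :
    MvPowerSeries (Fin n) ℂ :=
  coeffB t p.1 * shiftHom hq p.1 (coeffB t p.2) - coeffB t p.2 * shiftHom hq p.2 (coeffB t p.1)

theorem modifiedOperator_commutator (hq : q ≠ 0) (t : ℂ) (s : Fin n → ℂ) (r l : ℕ)
    (f : MvPowerSeries (Fin n) ℂ) :
    modifiedOperator q t s r (modifiedOperator q t s l f) -
        modifiedOperator q t s l (modifiedOperator q t s r f) =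
      ∑ p ∈ Finset.powersetCard r Finset.univ ×ˢ Finset.powersetCard l Finset.univ,
        C ((∏ i ∈ p.1, s i) * ∏ j ∈ p.2, s j) * commCoeff hq t p *
          qShift q p.1 (qShift q p.2 f) := by
  rw [modifiedOperator_modifiedOperator hq, modifiedOperator_modifiedOperator hq,
    Finset.sum_comm (s := Finset.powersetCard l Finset.univ), Finset.sum_product,
    ← Finset.sum_sub_distrib]
  refine Finset.sum_congr rfl fun I _ => ?_
  rw [← Finset.sum_sub_distrib]
  refine Finset.sum_congr rfl fun J _ => ?_
  rw [qShift_comm q J I, mul_comm (∏ i ∈ J, s i), commCoeff]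
  ring

theorem qShift_qShift_eq_of_ternaryCode_eq {p p' : Finset (Fin n) × Finset (Fin n)}
    (h : ternaryCode p = ternaryCode p') (f : MvPowerSeries (Fin n) ℂ) :
    qShift q p.1 (qShift q p.2 f) = qShift q p'.1 (qShift q p'.2 f) := by
  ext d
  rw [coeff_qShift, coeff_qShift, coeff_qShift, coeff_qShift, ← mul_assoc, ← mul_assoc]
  exact congrArg (· * coeff d f) (prod_mul_prod_eq_of_ternaryCode_eq h fun i => q ^ xExponent d i)

theorem sum_commCoeff_eq_of_ternaryCode (hq : q ≠ 0) (t : ℂ) (s : Fin n → ℂ)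
    (S : Finset (Finset (Fin n) × Finset (Fin n))) (f : MvPowerSeries (Fin n) ℂ)
    (p₀ : Finset (Fin n) × Finset (Fin n)) :
    ∑ p ∈ S with ternaryCode p = ternaryCode p₀, C ((∏ i ∈ p.1, s i) * ∏ j ∈ p.2, s j) *
        commCoeff hq t p * qShift q p.1 (qShift q p.2 f) =
      C ((∏ i ∈ p₀.1, s i) * ∏ j ∈ p₀.2, s j) *
        (∑ p ∈ S with ternaryCode p = ternaryCode p₀, commCoeff hq t p) *
          qShift q p₀.1 (qShift q p₀.2 f) := by
  rw [Finset.mul_sum, Finset.sum_mul]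
  refine Finset.sum_congr rfl fun p hp => ?_
  have hp := (Finset.mem_filter.1 hp).2
  rw [prod_mul_prod_eq_of_ternaryCode_eq hp, qShift_qShift_eq_of_ternaryCode_eq hp]

/-- For suitable parameters, the modified operators have a joint eigenfunction. -/
theorem exists_joint_eigenfunction (hq0 : q ≠ 0) (hq1 : q ≠ 1) {t : ℂ} (ht : t ≠ 0)
    {s : Fin n → ℂ}
    (hs : ∀ d : Fin n →₀ ℕ, (¬ ∃ k, d = diag n k) → ∑ i, s i * (q ^ xExponent d i - 1) ≠ 0) :
    ∃ f : MvPowerSeries (Fin n) ℂ, constantCoeff f = 1 ∧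
      ∀ r, ∃ η : PowerSeries ℂ, modifiedOperator q t s r f = ofNome η * f := by
  have hL := isNonresonant_modifiedOperator_one hq0 t hs
  obtain ⟨f, ε, hf0, hfk, hε, hf⟩ := hL.exists_eigenfunction
  exact ⟨f, hf0, fun r => hL.exists_eigenvalue (modifiedOperator_ofNome_mul hq0 t s r)
    (modifiedOperator_one_comm hq0 hq1 ht s r) hf0 hfk hε hf⟩

/-- On the curve `s_i = y ^ 3 ^ i` each resonance condition is a polynomial in `y` with distinct
exponents, nonzero because some `q ^ μ_i ≠ 1`. The powers of three also make the weight of a pair of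
sets equal to `y` to its ternary code, so different shifts carry different powers of `y`. -/
theorem exists_ternary_parameter (hq1 : ‖q‖ < 1) {Q : Polynomial ℂ} (hQ : Q ≠ 0) :
    ∃ y : ℂ, Q.eval y ≠ 0 ∧ ∀ d : Fin n →₀ ℕ, (¬ ∃ k, d = diag n k) →
      ∑ i : Fin n, y ^ 3 ^ (i : ℕ) * (q ^ xExponent d i - 1) ≠ 0 := by
  classical
  let P : Option {d : Fin n →₀ ℕ // ¬ ∃ k, d = diag n k} → Polynomial ℂ := fun o =>
    o.elim Q fun d =>
      ∑ i : Fin n, Polynomial.monomial (3 ^ (i : ℕ)) (q ^ xExponent d.1 i - 1)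
  obtain ⟨y, hy⟩ := exists_forall_eval_ne_zero P (by
    rintro (_ | ⟨d, hd⟩)
    · exact hQ
    · intro h
      refine hd (exists_eq_diag_of_xExponent fun i => ?_)
      by_contra hi
      have h1 := congrArg (fun F => Polynomial.coeff F (3 ^ (i : ℕ))) h
      change Polynomial.coeff (∑ j : Fin n, _) _ = 0 at h1
      rw [Polynomial.finsetSum_coeff, Finset.sum_eq_single i, Polynomial.coeff_monomial,
        if_pos rfl] at h1
      · exact zpow_ne_one_of_norm_lt_one hq1 hi (sub_eq_zero.1 h1)
      · intro j _ hj
        rw [Polynomial.coeff_monomial, if_neg]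
        exact fun h0 => hj (Fin.ext (Nat.pow_right_injective (by norm_num) h0))
      · exact fun h0 => absurd (Finset.mem_univ i) h0)
  refine ⟨y, hy none, fun d hd h => hy (some ⟨d, hd⟩) ?_⟩
  change Polynomial.eval y (∑ j : Fin n, _) = 0
  rw [Polynomial.eval_finsetSum, ← h]
  refine Finset.sum_congr rfl fun i _ => ?_
  rw [Polynomial.eval_monomial, mul_comm]

theorem constantCoeff_qShift (I : Finset (Fin n)) (f : MvPowerSeries (Fin n) ℂ) :
    constantCoeff (qShift q I f) = constantCoeff f := by
  rw [← coeff_zero_eq_constantCoeff_apply, coeff_qShift, shiftFactor_zero, one_mul,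
    coeff_zero_eq_constantCoeff_apply]

/-- The sum `D N` collects the commutator coefficients of one total shift and does not involve `s`.
By induction on the exponent `d`, the coefficients of all `D N` at `d` are packed into one
polynomial `Q` in `y`, which is shown to vanish. -/
theorem sum_commCoeff_eq_zero (hq0 : q ≠ 0) (hq1 : ‖q‖ < 1) {t : ℂ} (ht : t ≠ 0) (r l N : ℕ) :
    ∑ p ∈ Finset.powersetCard r Finset.univ ×ˢ Finset.powersetCard l Finset.univ with
      ternaryCode p = N, (commCoeff hq0 t p : MvPowerSeries (Fin n) ℂ) = 0 := by
  classical
  set S : Finset (Finset (Fin n) × Finset (Fin n)) :=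
    Finset.powersetCard r Finset.univ ×ˢ Finset.powersetCard l Finset.univ with hS
  set D : ℕ → MvPowerSeries (Fin n) ℂ := fun N => ∑ p ∈ S with ternaryCode p = N,
    commCoeff hq0 t p with hD
  suffices h : ∀ (d : Fin n →₀ ℕ) N, coeff d (D N) = 0 from MvPowerSeries.ext fun d => h d N
  intro d
  induction d using WellFoundedLT.induction with
  | ind d ih =>
    set Q : Polynomial ℂ := ∑ N ∈ S.image ternaryCode, Polynomial.monomial N (coeff d (D N))
      with hQ
    have hQ0 : Q = 0 := by
      by_contra hne
      obtain ⟨y, hy, hy'⟩ := exists_ternary_parameter (n := n) hq1 hne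
      obtain ⟨f, hf0, hf⟩ := exists_joint_eigenfunction hq0
        (by rintro rfl; simp at hq1) ht hy'
      obtain ⟨η, hη⟩ := hf r
      obtain ⟨κ, hκ⟩ := hf l
      -- The commutator annihilates the joint eigenfunction. As every `D N` vanishes below `d` and
      -- `f` has constant term `1`, the coefficient at `d` of this relation is `Q.eval y = 0`,
      -- against the choice of `y`.
      have h0 := modifiedOperator_commutator hq0 t (fun i : Fin n => y ^ 3 ^ (i : ℕ)) r l f
      rw [hη, hκ, modifiedOperator_ofNome_mul hq0, modifiedOperator_ofNome_mul hq0, hη, hκ,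
        mul_left_comm, sub_self, ← hS,
        ← Finset.sum_fiberwise_of_maps_to (fun p hp => Finset.mem_image_of_mem ternaryCode hp)]
        at h0
      have h1 := congrArg (coeff d) h0
      rw [map_zero, map_sum] at h1
      apply hy
      rw [h1, hQ, Polynomial.eval_finsetSum]
      refine Finset.sum_congr rfl fun N hN => ?_
      obtain ⟨p₀, -, rfl⟩ := Finset.mem_image.1 hN
      rw [sum_commCoeff_eq_of_ternaryCode, mul_assoc, coeff_C_mul,
        coeff_mul_of_coeff_lt_left fun e he => ih e he _, constantCoeff_qShift,
        constantCoeff_qShift, hf0, mul_one, Polynomial.eval_monomial, mul_comm,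
        Finset.prod_pow_eq_pow_sum, Finset.prod_pow_eq_pow_sum, ← pow_add]
      rfl
    intro N
    by_cases hN : N ∈ S.image ternaryCode
    · have h1 := congrArg (fun F => Polynomial.coeff F N) hQ0
      simp only [hQ, Polynomial.finsetSum_coeff, Polynomial.coeff_monomial,
        Finset.sum_ite_eq', if_pos hN, Polynomial.coeff_zero] at h1
      exact h1
    · have : S.filter (fun p => ternaryCode p = N) = ∅ :=
        Finset.filter_eq_empty_iff.2 fun p hp h => hN (h ▸ Finset.mem_image_of_mem _ hp)
      rw [hD]
      dsimp only
      rw [this, Finset.sum_empty, map_zero]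

theorem modifiedOperator_comm (hq0 : q ≠ 0) (hq1 : ‖q‖ < 1) {t : ℂ} (ht : t ≠ 0)
    (s : Fin n → ℂ) (r l : ℕ) (f : MvPowerSeries (Fin n) ℂ) :
    modifiedOperator q t s r (modifiedOperator q t s l f) =
      modifiedOperator q t s l (modifiedOperator q t s r f) := by
  classical
  rw [← sub_eq_zero, modifiedOperator_commutator hq0,
    ← Finset.sum_fiberwise_of_maps_to (fun p hp => Finset.mem_image_of_mem ternaryCode hp)]
  refine Finset.sum_eq_zero fun N hN => ?_
  obtain ⟨p₀, -, rfl⟩ := Finset.mem_image.1 hN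
  rw [sum_commCoeff_eq_of_ternaryCode, sum_commCoeff_eq_zero hq0 hq1 ht, mul_zero, zero_mul]

end Ruijsenaars

/-! ### The generating operator -/

namespace Ruijsenaars

open MvPowerSeries

variable {n : ℕ} [NeZero n] {q : ℂ}

/-- The generating combination `∑ r, u ^ r 𝓔^{(r)}` of the modified operators. -/
noncomputable def generatingOperator (q t : ℂ) (s : Fin n → ℂ) (u : ℂ)
    (f : MvPowerSeries (Fin n) ℂ) : MvPowerSeries (Fin n) ℂ :=
  ∑ r ∈ Finset.Icc 1 n, C (u ^ r) * modifiedOperator q t s r f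

/-- The diagonal entries of the generating operator. -/
noncomputable def generatingEntry (q : ℂ) (s : Fin n → ℂ) (u : ℂ) (d : Fin n →₀ ℕ) : ℂ :=
  ∑ r ∈ Finset.Icc 1 n, u ^ r * diagEntry q s r d

theorem generatingEntry_add_one (q : ℂ) (s : Fin n → ℂ) (u : ℂ) (d : Fin n →₀ ℕ) :
    generatingEntry q s u d + 1 = ∏ i, (1 + s i * q ^ xExponent d i * u) := by
  classical
  rw [Finset.prod_one_add, Finset.sum_powerset, Finset.card_univ, Fintype.card_fin,
    Finset.range_eq_Ico, Finset.sum_eq_sum_Ico_succ_bot n.succ_pos, Finset.powersetCard_zero,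
    Finset.sum_singleton, Finset.prod_empty, add_comm, generatingEntry]
  refine congrArg (1 + ·) (Finset.sum_congr rfl fun r _ => ?_)
  rw [diagEntry, Finset.mul_sum]
  refine Finset.sum_congr rfl fun I hI => ?_
  rw [Finset.prod_mul_distrib (g := fun _ => u), Finset.prod_const,
    (Finset.mem_powersetCard.1 hI).2, mul_comm]

/-- For generic `u` the diagonal entries of the generating operator separate the monomials from
the powers of the nome. -/
theorem exists_generatingEntry_ne (hq0 : q ≠ 0) (hq1 : ‖q‖ < 1) {s : Fin n → ℂ}
    (hs0 : ∀ i, s i ≠ 0)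
    (hs : ∀ i j : Fin n, i < j → ∀ m : ℤ, m ≠ 0 → s j / s i ≠ q ^ m) :
    ∃ u : ℂ, ∀ d : Fin n →₀ ℕ, generatingEntry q s u d = generatingEntry q s u 0 →
      ∃ k, d = diag n k := by
  classical
  have heval : ∀ (u : ℂ) (d : Fin n →₀ ℕ), Polynomial.eval u
      (∏ i, (1 + Polynomial.C (s i * q ^ xExponent d i) * Polynomial.X)) =
      generatingEntry q s u d + 1 := fun u d => by
    rw [generatingEntry_add_one, Polynomial.eval_prod]
    simp
  obtain ⟨u, hu⟩ := exists_forall_eval_ne_zero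
    (fun d : {d : Fin n →₀ ℕ // ¬ ∃ k, d = diag n k} =>
      (∏ i, (1 + Polynomial.C (s i * q ^ xExponent d.1 i) * Polynomial.X) -
        ∏ i, (1 + Polynomial.C (s i * q ^ xExponent (0 : Fin n →₀ ℕ) i) * Polynomial.X))) (by
    rintro ⟨d, hd⟩ h
    refine hd (exists_eq_diag_of_xExponent fun i => ?_)
    by_contra hi
    have ha : s i * q ^ xExponent d i ≠ 0 := mul_ne_zero (hs0 i) (zpow_ne_zero _ hq0)
    -- If the two products agree as polynomials in `u`, a root of the factor `i` on the left is a
    -- root of some factor `j` on the right, that is `s j = s i * q ^ μ_i` with `μ_i ≠ 0`. The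
    -- condition on `s` excludes `j ≠ i`, and `|q| < 1` excludes `j = i`.
    have h1 := congrArg (Polynomial.eval (-(s i * q ^ xExponent d i)⁻¹)) (sub_eq_zero.1 h)
    rw [heval, heval, generatingEntry_add_one, generatingEntry_add_one,
      Finset.prod_eq_zero (Finset.mem_univ i) (by rw [mul_neg, mul_inv_cancel₀ ha, add_neg_cancel]),
      eq_comm, Finset.prod_eq_zero_iff] at h1
    obtain ⟨j, -, hj⟩ := h1
    have hj' : s j = s i * q ^ xExponent d i := by
      rw [xExponent, Finsupp.zero_apply, Finsupp.zero_apply, sub_self, zpow_zero, mul_one,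
        mul_neg, ← sub_eq_add_neg, sub_eq_zero, eq_comm, ← div_eq_mul_inv, div_eq_one_iff_eq ha]
        at hj
      exact hj
    rcases lt_trichotomy i j with hij | rfl | hij
    · exact hs i j hij _ hi (by rw [hj', mul_div_cancel_left₀ _ (hs0 i)])
    · exact zpow_ne_one_of_norm_lt_one hq1 hi (mul_eq_left₀ (hs0 i) |>.1 hj'.symm)
    · refine hs j i hij _ (neg_ne_zero.2 hi) ?_
      rw [hj', zpow_neg, div_mul_cancel_left₀ (hs0 i)])
  refine ⟨u, fun d h => ?_⟩
  by_contra hd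
  apply hu ⟨d, hd⟩
  rw [Polynomial.eval_sub, heval, heval, h, sub_self]

theorem isNonresonant_generatingOperator (hq : q ≠ 0) (t : ℂ) {s : Fin n → ℂ} {u : ℂ}
    (hu : ∀ d : Fin n →₀ ℕ, generatingEntry q s u d = generatingEntry q s u 0 →
      ∃ k, d = diag n k) :
    IsNonresonant (generatingOperator q t s u) (generatingEntry q s u) where
  map_sub f g := by
    rw [generatingOperator, generatingOperator, generatingOperator, ← Finset.sum_sub_distrib]
    refine Finset.sum_congr rfl fun r _ => ?_
    rw [modifiedOperator_sub hq, mul_sub]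
  map_ofNome_mul γ f := by
    rw [generatingOperator, generatingOperator, Finset.mul_sum]
    refine Finset.sum_congr rfl fun r _ => ?_
    rw [modifiedOperator_ofNome_mul hq, mul_left_comm]
  coeff_eq f d h := by
    rw [generatingOperator, generatingEntry, map_sum, Finset.sum_mul]
    refine Finset.sum_congr rfl fun r _ => ?_
    rw [coeff_C_mul, coeff_modifiedOperator q t s r h, mul_assoc]
  exists_eq_diag := hu

theorem modifiedOperator_sum_C_mul (hq : q ≠ 0) (t : ℂ) (s : Fin n → ℂ) (r : ℕ) {ι : Type*}
    (A : Finset ι) (c : ι → ℂ) (F : ι → MvPowerSeries (Fin n) ℂ) :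
    modifiedOperator q t s r (∑ a ∈ A, C (c a) * F a) =
      ∑ a ∈ A, C (c a) * modifiedOperator q t s r (F a) := by
  simp_rw [modifiedOperator, Finset.mul_sum]
  rw [Finset.sum_comm]
  refine Finset.sum_congr rfl fun I _ => ?_
  rw [← shiftHom_apply hq, map_sum, Finset.mul_sum]
  refine Finset.sum_congr rfl fun a _ => ?_
  rw [map_mul, shiftHom_C, shiftHom_apply, mul_left_comm]

theorem generatingOperator_comm (hq0 : q ≠ 0) (hq1 : ‖q‖ < 1) {t : ℂ} (ht : t ≠ 0)
    (s : Fin n → ℂ) (u : ℂ) (r : ℕ) (f : MvPowerSeries (Fin n) ℂ) :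
    generatingOperator q t s u (modifiedOperator q t s r f) =
      modifiedOperator q t s r (generatingOperator q t s u f) := by
  rw [generatingOperator, generatingOperator, modifiedOperator_sum_C_mul hq0]
  refine Finset.sum_congr rfl fun l _ => ?_
  rw [modifiedOperator_comm hq0 hq1 ht]

theorem ofNome_C (c : ℂ) : (ofNome (PowerSeries.C c) : MvPowerSeries (Fin n) ℂ) = C c := by
  classical
  ext d
  by_cases hd : ∃ k, d = diag n k
  · obtain ⟨k, rfl⟩ := hd
    rw [coeff_ofNome_diag, PowerSeries.coeff_C, coeff_C, ← diag_zero]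
    exact if_congr diag_injective.eq_iff.symm rfl rfl
  · rw [coeff_ofNome_of_ne _ fun k hk => hd ⟨k, hk⟩, coeff_C, if_neg]
    rintro rfl
    exact hd ⟨0, diag_zero.symm⟩

theorem ofNome_sum {ι : Type*} (A : Finset ι) (γ : ι → PowerSeries ℂ) :
    (ofNome (∑ a ∈ A, γ a) : MvPowerSeries (Fin n) ℂ) = ∑ a ∈ A, ofNome (γ a) := by
  classical
  induction A using Finset.induction_on with
  | empty => rw [Finset.sum_empty, Finset.sum_empty, ofNome_zero]
  | insert a A ha ih => rw [Finset.sum_insert ha, Finset.sum_insert ha, ofNome_add, ih]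

theorem IsFormalSolution.generatingOperator_eq {t : ℂ} {s : Fin n → ℂ}
    {g : MvPowerSeries (Fin n) ℂ} {η : ℕ → PowerSeries ℂ} (hg : IsFormalSolution q t s g η)
    (u : ℂ) : ∃ ζ : PowerSeries ℂ, PowerSeries.constantCoeff ζ = generatingEntry q s u 0 ∧
      generatingOperator q t s u g = ofNome ζ * g := by
  refine ⟨∑ r ∈ Finset.Icc 1 n, PowerSeries.C (u ^ r) * η r, ?_, ?_⟩
  · rw [map_sum, generatingEntry]
    refine Finset.sum_congr rfl fun r hr => ?_
    rw [map_mul, PowerSeries.constantCoeff_C]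
    -- The constant term of an eigenvalue is forced to be the diagonal entry at `0`, as uniqueness
    -- for nonresonant operators requires.
    have h1 := congrArg (coeff 0) (hg.2 r hr)
    rw [coeff_modifiedOperator q t s r fun e he => absurd he (by simp),
      coeff_zero_eq_constantCoeff_apply, coeff_zero_eq_constantCoeff_apply, map_mul,
      constantCoeff_ofNome, hg.1, mul_one, mul_one] at h1
    rw [h1]
  · rw [generatingOperator, ofNome_sum, Finset.sum_mul]
    refine Finset.sum_congr rfl fun r hr => ?_
    rw [hg.2 r hr, ofNome_mul, ofNome_C, mul_assoc]

end Ruijsenaars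

/-! ### Existence and uniqueness of the formal solution -/

theorem theorem2p5 (n : ℕ) [NeZero n] (q t : ℂ) (hq0 : q ≠ 0) (hq1 : ‖q‖ < 1) (ht : t ≠ 0)
    (s : Fin n → ℂ) (hs0 : ∀ i, s i ≠ 0)
    (hs : ∀ i j : Fin n, i < j → ∀ m : ℤ, m ≠ 0 → s j / s i ≠ q ^ m) :
    ∃ (f : MvPowerSeries (Fin n) ℂ) (ε : ℕ → PowerSeries ℂ),
      Ruijsenaars.IsFormalSolution q t s f ε ∧
      (∀ (g : MvPowerSeries (Fin n) ℂ) (η : ℕ → PowerSeries ℂ),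
        Ruijsenaars.IsFormalSolution q t s g η → ∀ r ∈ Finset.Icc 1 n, η r = ε r) ∧
      (∀ g : MvPowerSeries (Fin n) ℂ,
        (∃ η : ℕ → PowerSeries ℂ, Ruijsenaars.IsFormalSolution q t s g η) ↔
          ∃ γ : PowerSeries ℂ, PowerSeries.constantCoeff γ = 1 ∧
            g = Ruijsenaars.ofNome γ * f) := by
  open Ruijsenaars in
  obtain ⟨u, hu⟩ := exists_generatingEntry_ne hq0 hq1 hs0 hs
  have hL := isNonresonant_generatingOperator hq0 t hu
  obtain ⟨f, ζ, hf0, hfk, hζ, hf⟩ := hL.exists_eigenfunction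
  -- Each modified operator commutes with the generating operator, so it maps the eigenfunction `f`
  -- to a multiple of `f` by a series in the nome.
  choose ε hε using fun r => hL.exists_eigenvalue (modifiedOperator_ofNome_mul hq0 t s r)
    (generatingOperator_comm hq0 hq1 ht s u r) hf0 hfk hζ hf
  have hε' : ∀ (γ : PowerSeries ℂ) r, modifiedOperator q t s r (ofNome γ * f) =
      ofNome (ε r) * (ofNome γ * f) := fun γ r => by
    rw [modifiedOperator_ofNome_mul hq0, hε, mul_left_comm]
  have key : ∀ (g : MvPowerSeries (Fin n) ℂ) (η : ℕ → PowerSeries ℂ),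
      IsFormalSolution q t s g η →
        ∃ γ : PowerSeries ℂ, PowerSeries.constantCoeff γ = 1 ∧ g = ofNome γ * f := by
    intro g η hg
    obtain ⟨κ, hκ, hgκ⟩ := hg.generatingOperator_eq u
    obtain ⟨γ, rfl⟩ := hL.eq_ofNome_mul hf0 hfk hκ hf hgκ
    refine ⟨γ, ?_, rfl⟩
    have h1 := hg.1
    rw [map_mul, constantCoeff_ofNome, hf0, mul_one] at h1
    exact h1
  refine ⟨f, ε, ⟨hf0, fun r _ => hε r⟩, ?_, fun g => ⟨fun ⟨η, hg⟩ => key g η hg, ?_⟩⟩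
  · intro g η hg r hr
    obtain ⟨γ, -, rfl⟩ := key g η hg
    have hne : ofNome γ * f ≠ 0 := fun h0 => by
      have h1 := hg.1
      rw [h0, map_zero] at h1
      exact zero_ne_one h1
    -- Both eigenvalues act on the same nonzero series, which can be cancelled in a domain.
    exact ofNome_injective (mul_right_cancel₀ hne ((hg.2 r hr).symm.trans (hε' γ r)))
  · rintro ⟨γ, hγ, rfl⟩
    exact ⟨ε, by rw [map_mul, constantCoeff_ofNome, hγ, hf0, mul_one], fun r _ => hε' γ r⟩
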